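/- Let $\mathbb K$ be a field of characteristic zero, let $U$ be a $\mathbb K$-vector space of finite dimension $r\ge 1$, and let $X=(x_1,\dots,x_N)$ be a finite sequence of vectors spanning $U$. Let $\mathfrak M(X)$ be its matroid on $[N]$ (a set $I\subseteq[N]$ is independent iff $(x_i)_{i\in I}$ is linearly independent), and let $\mathcal L(X)$ be the lattice of flats of $\mathfrak M(X)$. Let $k\ge -1$ be an integer and $J\subseteq\mathcal L(X)$ a non-empty upper set; if $k=-1$, assume in addition that $J$ contains all hyperplanes, i.e. all flats of rank $r-1$. For $A\subseteq [N]$ put $\chi(A)=1$ if the closure of $A$ lies in $J$, and $\chi(A)=0$ otherwise. For $Y\subseteq[N]$ let $p_Y=\prod_{i\in Y}x_i\in\operatorname{Sym}(U)$. Define $\mathcal P(X,k,J)$ as the linear span in $\operatorname{Sym}(U)$ of - $\{\,f\,p_Y : Y\subseteq[N],\ f\in \operatorname{Sym}(U),\ 0\le\deg f\le \chi([N]\setminus Y)+k-1\,\}$ if $k\ge1$; - $\{\,p_Y : Y\subseteq [N],\ \operatorname{clos}([N]\setminus Y)\in J\,\}$ if $k=0$; - $\{\,p_Y : Y\subseteq[N],\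 |Y\setminus C|<|[N]\setminus C|-1+\chi(C)\ \text{for all flats } C\ne[N]\,\}$ if $k=-1$. This is a graded subspace of $\operatorname{Sym}(U)$; its Hilbert series is $\sum_{i\ge0}\dim\bigl(\mathcal P(X,k,J)\cap\operatorname{Sym}^i(U)\bigr)\,t^i$. The Hilbert series of $\mathcal P(X,k,J)$ depends only on the matroid $\mathfrak M(X)$ together with $k$ and $J$, and not on the representation $X$: if $X'=(x'_1,\dots,x'_N)$ is a finite sequence spanning a vector space $U'$ of finite dimension $\geq 1$ over a field $\mathbb K'$ of characteristic zero, and $\mathfrak M(X')=\mathfrak M(X)$, then $\mathcal P(X',k,J)$ and $\mathcal P(X,k,J)$ have the same Hilbert series. -/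

import Mathlib

namespace Zonotopal

/-! ## The matroid of a finite family of vectors -/

/-- The matroid `𝔐(X)` on the index set of a finite family `X = (x i)` of vectors:
a set of indices is independent iff the corresponding subfamily is linearly independent. -/
noncomputable def linearMatroid (K : Type*) [Field K] {ι U : Type*} [Finite ι]
    [AddCommGroup U] [Module K U] (x : ι → U) : Matroid ι :=
  (IndepMatroid.ofFinite (E := Set.univ) Set.finite_univ (fun I => LinearIndepOn K x I)
    (linearIndepOn_empty K x)
    (fun _ _ hJ hIJ => hJ.mono hIJ)
    (by
      intro I J hI hJ hlt
      by_contra! hcon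
      have hsub : x '' J ⊆ Submodule.span K (x '' I) := by
        rintro _ ⟨j, hj, rfl⟩
        by_cases hjI : j ∈ I
        · exact Submodule.subset_span ⟨j, hjI, rfl⟩
        · by_contra hmem
          exact hcon j hj hjI (hI.insert hmem)
      have hle : Submodule.span K (x '' J) ≤ Submodule.span K (x '' I) :=
        Submodule.span_le.2 hsub
      have card (A : Set ι) (hA : LinearIndepOn K x A) :
          Module.finrank K (Submodule.span K (x '' A)) = A.ncard := by
        classical
        have : Fintype A := Fintype.ofFinite A
        have h := finrank_span_eq_card (R := K) hA
        rw [Set.ncard_eq_toFinset_card', Set.toFinset_card, ← h, Set.image_eq_range]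
      have : Module.Finite K (Submodule.span K (x '' I)) :=
        FiniteDimensional.span_of_finite K ((Set.toFinite I).image x)
      have := Submodule.finrank_mono hle
      rw [card I hI, card J hJ] at this
      omega)
    (fun _ _ => Set.subset_univ _)).matroid

theorem linearMatroid_indep_iff (K : Type*) [Field K] {ι U : Type*} [Finite ι]
    [AddCommGroup U] [Module K U] (x : ι → U) (I : Set ι) :
    (linearMatroid K x).Indep I ↔ LinearIndepOn K x I := by
  simp [linearMatroid]

theorem linearMatroid_ground (K : Type*) [Field K] {ι U : Type*} [Finite ι]
    [AddCommGroup U] [Module K U] (x : ι → U) :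
    (linearMatroid K x).E = Set.univ := rfl

/-- A hyperplane of a matroid: a flat whose rank is one less than the rank of the matroid. -/
def IsHyperplane {ι : Type*} (M : Matroid ι) (C : Set ι) : Prop :=
  M.IsFlat C ∧ M.eRk C + 1 = M.eRank

/-- `J` is an upper set in the lattice of flats of `M`. -/
def IsUpperSetOfFlats {ι : Type*} (M : Matroid ι) (J : Set (Set ι)) : Prop :=
  (∀ C ∈ J, M.IsFlat C) ∧ ∀ C ∈ J, ∀ C', M.IsFlat C' → C ⊆ C' → C' ∈ J

open Classical in
/-- The indicator function of `J`, extended to all sets of indices by `χ(A) = χ(clos A)`. -/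
noncomputable def chi {ι : Type*} (M : Matroid ι) (J : Set (Set ι)) (A : Set ι) : ℤ :=
  if M.closure A ∈ J then 1 else 0

/-! ## The symmetric algebra and Hilbert series -/

/-- The homogeneous component `Sym^i(U)` of the symmetric algebra: the span of all products
of `i` elements of `U`. -/
noncomputable def symPiece (K : Type*) [Field K] (U : Type*) [AddCommGroup U] [Module K U]
    (i : ℕ) : Submodule K (SymmetricAlgebra K U) :=
  LinearMap.range (SymmetricAlgebra.ι K U) ^ i

/-- The elements of `Sym(U)` of degree at most `d` (only `0` if `d < 0`). -/
noncomputable def symDegreeLE (K : Type*) [Field K] (U : Type*) [AddCommGroup U] [Module K U]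
    (d : ℤ) : Submodule K (SymmetricAlgebra K U) :=
  ⨆ (j : ℕ) (_ : (j : ℤ) ≤ d), symPiece K U j

/-- The Hilbert series `∑ dim (W ∩ Sym^i(U)) t^i` of a graded subspace `W` of `Sym(U)`. -/
noncomputable def hilbertSeries {K : Type*} [Field K] {U : Type*} [AddCommGroup U] [Module K U]
    (W : Submodule K (SymmetricAlgebra K U)) : PowerSeries ℕ :=
  PowerSeries.mk fun i => Module.finrank K ↥(W ⊓ symPiece K U i)

/-! ## Hierarchical zonotopal spaces -/

/-- The product `p_Y = ∏_{i ∈ Y} x_i` in `Sym(U)`. -/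
noncomputable def pProd (K : Type*) [Field K] {ι U : Type*} [AddCommGroup U] [Module K U]
    (x : ι → U) (Y : Finset ι) : SymmetricAlgebra K U :=
  ∏ i ∈ Y, SymmetricAlgebra.ι K U (x i)

/-- The generating set `S(X, k, J)`, for integers `k ≥ -1`; the cases are `k = -1`, `k = 0`
and `k ≥ 1`. -/
noncomputable def pGenerators (K : Type*) [Field K] {ι U : Type*} [Finite ι] [AddCommGroup U]
    [Module K U] (x : ι → U) (k : ℤ) (J : Set (Set ι)) : Set (SymmetricAlgebra K U) :=
  if k = -1 then
    {q | ∃ Y : Finset ι,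
      (∀ C : Set ι, (linearMatroid K x).IsFlat C → C ≠ Set.univ →
        (((Y : Set ι) \ C).ncard : ℤ) < (Cᶜ.ncard : ℤ) - 1 + chi (linearMatroid K x) J C) ∧
      q = pProd K x Y}
  else if k = 0 then
    {q | ∃ Y : Finset ι, (linearMatroid K x).closure (Y : Set ι)ᶜ ∈ J ∧ q = pProd K x Y}
  else
    {q | ∃ (Y : Finset ι) (f : SymmetricAlgebra K U),
      f ∈ symDegreeLE K U (chi (linearMatroid K x) J (Y : Set ι)ᶜ + k - 1) ∧
      q = f * pProd K x Y}

/-- The hierarchical zonotopal space `P(X, k, J)`, the span of `S(X, k, J)`. -/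
noncomputable def pSpace (K : Type*) [Field K] {ι U : Type*} [Finite ι] [AddCommGroup U]
    [Module K U] (x : ι → U) (k : ℤ) (J : Set (Set ι)) : Submodule K (SymmetricAlgebra K U) :=
  Submodule.span K (pGenerators K x k J)

/-! ## The Hilbert series of `P(X, k, J)` is well defined -/

theorem symPiece_finite (K : Type*) [Field K] (U : Type*) [AddCommGroup U] [Module K U]
    [FiniteDimensional K U] (i : ℕ) : Module.Finite K (symPiece K U i) := by
  refine Module.Finite.iff_fg.2 ?_
  exact Submodule.FG.pow (Module.Finite.iff_fg.1 inferInstance) i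

theorem pProd_mem (K : Type*) [Field K] {ι U : Type*} [AddCommGroup U] [Module K U]
    (x : ι → U) (Y : Finset ι) : pProd K x Y ∈ symPiece K U Y.card := by
  classical
  induction Y using Finset.induction_on with
  | empty => simp [pProd, symPiece]
  | insert a s ha ih =>
    rw [pProd, Finset.prod_insert ha, Finset.card_insert_of_notMem ha, symPiece, pow_succ']
    exact Submodule.mul_mem_mul ⟨_, rfl⟩ ih

theorem pSpace_graded (K : Type*) [Field K] {ι U : Type*} [Finite ι] [AddCommGroup U]
    [Module K U] (x : ι → U) (k : ℤ) (J : Set (Set ι)) :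
    pSpace K x k J = ⨆ i, pSpace K x k J ⊓ symPiece K U i := by
  refine le_antisymm ?_ (iSup_le fun i => inf_le_left)
  have key : ∀ q ∈ pGenerators K x k J, ∀ i, q ∈ symPiece K U i →
      q ∈ ⨆ i, pSpace K x k J ⊓ symPiece K U i := fun q hq i hi =>
    Submodule.mem_iSup_of_mem i ⟨Submodule.subset_span hq, hi⟩
  refine Submodule.span_le.2 fun q hq => ?_
  have hq' := hq
  unfold pGenerators at hq'
  split_ifs at hq' with h1 h2
  · obtain ⟨Y, -, rfl⟩ := hq'
    exact key _ hq _ (pProd_mem K x Y)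
  · obtain ⟨Y, -, rfl⟩ := hq'
    exact key _ hq _ (pProd_mem K x Y)
  · obtain ⟨Y, f, hf, rfl⟩ := hq'
    have hle : symDegreeLE K U (chi (linearMatroid K x) J (Y : Set ι)ᶜ + k - 1) ≤
        (⨆ i, pSpace K x k J ⊓ symPiece K U i).comap
          (LinearMap.mulRight K (pProd K x Y)) := by
      refine iSup₂_le fun j hj g hg => ?_
      refine key _ ?_ (j + Y.card) ?_
      · unfold pGenerators
        rw [if_neg h1, if_neg h2]
        exact ⟨Y, g, Submodule.mem_iSup_of_mem j (Submodule.mem_iSup_of_mem hj hg), rfl⟩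
      · have := Submodule.mul_mem_mul hg (pProd_mem K x Y)
        rwa [symPiece, symPiece, ← pow_add] at this
    exact hle hf

end Zonotopal

/-! The graded dimensions obey a deletion-contraction recursion that sees only the matroid. If `x i
≠ 0` lies in the span of the other vectors, multiplication by `x i` and the map Sym(U) → Sym(U/⟨x
i⟩) give exact sequences 0 → P(X∖i)_d → P(X)_{d+1} → P(X/i)_{d+1} → 0. Zero vectors can be
discarded. When no vector lies in the span of the others, X is a basis and P(X) is spanned by
monomials whose exponents are described by `k` and `J` alone. Induction on the number of vectors
then gives the theorem.

The generators show only half of the exactness: `ι_mul_mem_zSpace` (products with `x i` stay inside)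
and `zSpace_contract_le` (generators of the contraction lift). The other half needs a description of
the same space by conditions, `zKer`: whenever η ≠ 0 vanishes on the `x c` with c ∈ C, the translate
f(· + tη) has t-degree below |E∖C| + k + χ(C). Such conditions descend to the contraction
(`symMap_mem_zKer`) and survive division by `x i` (`mem_zKer_of_ι_mul_mem`). The equality of both
descriptions, `zSpace_eq_zKer`, is proved by the same induction. Characteristic zero serves only to
make the fields infinite, for arguments with generic directions and polynomial identities.

To stay on one index type, the upper set of flats is replaced by a predicate `G` on finite subsets:
deletion keeps `G`, contraction by i turns `G A` into `G (insert i A)`. -/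

namespace Zonotopal

/-! ### Symmetric algebras: grading, functoriality, and degree along a direction. -/

section SymmetricAlgebra

variable {K : Type*} [Field K] {U U' : Type*} [AddCommGroup U] [Module K U]
  [AddCommGroup U'] [Module K U']

/-- The homomorphism `Sym(U) → Sym(U)[t]` with `u ↦ u t`. -/
noncomputable def gradeHom (K : Type*) [Field K] (U : Type*) [AddCommGroup U] [Module K U] :
    SymmetricAlgebra K U →ₐ[K] Polynomial (SymmetricAlgebra K U) :=
  SymmetricAlgebra.lift
    ((LinearMap.mulRight K (Polynomial.X : Polynomial (SymmetricAlgebra K U))).comp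
      (Polynomial.CAlgHom.toLinearMap.comp (SymmetricAlgebra.ι K U)))

theorem gradeHom_ι (u : U) :
    gradeHom K U (SymmetricAlgebra.ι K U u) =
      Polynomial.C (SymmetricAlgebra.ι K U u) * Polynomial.X := by
  simp [gradeHom]

/-- The projection of `Sym(U)` onto its homogeneous component of degree `d`. -/
noncomputable def symProj (K : Type*) [Field K] (U : Type*) [AddCommGroup U] [Module K U]
    (d : ℕ) : SymmetricAlgebra K U →ₗ[K] SymmetricAlgebra K U :=
  ((Polynomial.lcoeff (SymmetricAlgebra K U) d).restrictScalars K).comp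
    (gradeHom K U).toLinearMap

theorem symProj_apply (d : ℕ) (f : SymmetricAlgebra K U) :
    symProj K U d f = (gradeHom K U f).coeff d := rfl

theorem ι_mem_symPiece_one (u : U) : SymmetricAlgebra.ι K U u ∈ symPiece K U 1 := by
  simp [symPiece]

theorem mul_mem_symPiece {f g : SymmetricAlgebra K U} {m n : ℕ} (hf : f ∈ symPiece K U m)
    (hg : g ∈ symPiece K U n) : f * g ∈ symPiece K U (m + n) := by
  rw [symPiece, pow_add]
  exact Submodule.mul_mem_mul hf hg

/-- Induction along the homogeneous components of the symmetric algebra. -/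
theorem symPiece_induction {p : ℕ → SymmetricAlgebra K U → Prop}
    (algebraMap : ∀ c : K, p 0 (algebraMap K _ c))
    (add : ∀ n f g, p n f → p n g → p n (f + g))
    (ι_mul : ∀ n u f, p n f → p (n + 1) (SymmetricAlgebra.ι K U u * f))
    {n : ℕ} {f : SymmetricAlgebra K U} (hf : f ∈ symPiece K U n) : p n f := by
  induction n generalizing f with
  | zero =>
    rw [symPiece, pow_zero, Submodule.mem_one] at hf
    obtain ⟨c, rfl⟩ := hf
    exact algebraMap c
  | succ n ih =>
    rw [symPiece, pow_succ'] at hf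
    refine Submodule.mul_induction_on hf ?_ (add _)
    rintro _ ⟨u, rfl⟩ g hg
    exact ι_mul n u g (ih hg)

theorem gradeHom_of_mem {f : SymmetricAlgebra K U} {n : ℕ} (hf : f ∈ symPiece K U n) :
    gradeHom K U f = Polynomial.C f * Polynomial.X ^ n := by
  refine symPiece_induction (p := fun n f => gradeHom K U f = Polynomial.C f * Polynomial.X ^ n)
    ?_ ?_ ?_ hf
  · intro c
    rw [AlgHom.commutes, pow_zero, mul_one]
    rfl
  · intro n f g hf hg
    rw [map_add, hf, hg, map_add, add_mul]
  · intro n u f hf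
    rw [map_mul, hf, gradeHom_ι, map_mul, pow_succ]
    ring

theorem symProj_of_mem {f : SymmetricAlgebra K U} {n : ℕ} (hf : f ∈ symPiece K U n) (d : ℕ) :
    symProj K U d f = if d = n then f else 0 := by
  rw [symProj_apply, gradeHom_of_mem hf, Polynomial.coeff_C_mul_X_pow]

theorem symProj_mem (d : ℕ) (f : SymmetricAlgebra K U) : symProj K U d f ∈ symPiece K U d := by
  induction f using SymmetricAlgebra.induction generalizing d with
  | algebraMap r =>
    rw [symProj_of_mem (n := 0) (by rw [symPiece, pow_zero]; exact Submodule.algebraMap_mem r)]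
    split_ifs with h
    · rw [h, symPiece, pow_zero]
      exact Submodule.algebraMap_mem r
    · exact zero_mem _
  | ι u =>
    rw [symProj_of_mem (ι_mem_symPiece_one u)]
    split_ifs with h
    · rw [h]
      exact ι_mem_symPiece_one u
    · exact zero_mem _
  | mul a b ha hb =>
    rw [symProj_apply, map_mul, Polynomial.coeff_mul]
    refine Submodule.sum_mem _ fun p hp => ?_
    rw [← Finset.HasAntidiagonal.mem_antidiagonal.1 hp]
    exact mul_mem_symPiece (ha p.1) (hb p.2)
  | add a b ha hb =>
    rw [map_add]
    exact add_mem (ha d) (hb d)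

theorem mem_symPiece_iff {d : ℕ} {f : SymmetricAlgebra K U} :
    f ∈ symPiece K U d ↔ symProj K U d f = f :=
  ⟨fun h => by rw [symProj_of_mem h, if_pos rfl], fun h => h ▸ symProj_mem d f⟩

theorem symProj_succ_ι_mul (d : ℕ) (u : U) (f : SymmetricAlgebra K U) :
    symProj K U (d + 1) (SymmetricAlgebra.ι K U u * f) =
      SymmetricAlgebra.ι K U u * symProj K U d f := by
  rw [symProj_apply, map_mul, gradeHom_ι, mul_assoc, Polynomial.coeff_C_mul,
    Polynomial.coeff_X_mul, symProj_apply]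

theorem symProj_zero_ι_mul (u : U) (f : SymmetricAlgebra K U) :
    symProj K U 0 (SymmetricAlgebra.ι K U u * f) = 0 := by
  rw [symProj_apply, map_mul, gradeHom_ι, mul_assoc, Polynomial.coeff_C_mul,
    Polynomial.coeff_X_mul_zero, mul_zero]

/-- A linear functional that is nonzero at u extends to an algebra homomorphism Sym(U) → K. -/
theorem ι_ne_zero {u : U} (hu : u ≠ 0) : SymmetricAlgebra.ι K U u ≠ 0 := by
  intro h
  refine hu ((Module.forall_dual_apply_eq_zero_iff K u).1 fun φ => ?_)
  simpa using congrArg (SymmetricAlgebra.lift φ) h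

/-- The homomorphism of symmetric algebras induced by a linear map. -/
noncomputable def symMap (φ : U →ₗ[K] U') : SymmetricAlgebra K U →ₐ[K] SymmetricAlgebra K U' :=
  SymmetricAlgebra.lift ((SymmetricAlgebra.ι K U').comp φ)

@[simp]
theorem symMap_ι (φ : U →ₗ[K] U') (u : U) :
    symMap φ (SymmetricAlgebra.ι K U u) = SymmetricAlgebra.ι K U' (φ u) := by
  simp [symMap]

theorem symMap_pProd {ι : Type*} (φ : U →ₗ[K] U') (x : ι → U) (Y : Finset ι) :
    symMap φ (pProd K x Y) = pProd K (fun i => φ (x i)) Y := by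
  simp [pProd]

theorem map_symMap_symPiece (φ : U →ₗ[K] U') (hφ : Function.Surjective φ) (d : ℕ) :
    (symPiece K U d).map (symMap φ).toLinearMap = symPiece K U' d := by
  rw [symPiece, Submodule.map_pow, symPiece]
  congr 1
  rw [← LinearMap.range_comp]
  have : (symMap φ).toLinearMap.comp (SymmetricAlgebra.ι K U) =
      (SymmetricAlgebra.ι K U').comp φ := by
    ext u
    simp
  rw [this, LinearMap.range_comp, LinearMap.range_eq_top.2 hφ, LinearMap.range_eq_map]

theorem symProj_symMap (φ : U →ₗ[K] U') (d : ℕ) (f : SymmetricAlgebra K U) :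
    symProj K U' d (symMap φ f) = symMap φ (symProj K U d f) := by
  have h : (gradeHom K U').comp (symMap φ) =
      (Polynomial.mapAlgHom (symMap φ)).comp (gradeHom K U) := by
    ext u : 2
    simp [gradeHom_ι]
  have := congrArg (fun q => Polynomial.coeff q d) (DFunLike.congr_fun h f)
  simpa [symProj_apply, Polynomial.coeff_map] using this

/-- The kernel of `Sym(U) → Sym(U / ⟨u⟩)` is the ideal generated by `u`. -/
theorem exists_eq_ι_mul_of_symMap_mkQ_eq_zero (u : U) (f : SymmetricAlgebra K U)
    (hf : symMap (K ∙ u).mkQ f = 0) : ∃ g, f = SymmetricAlgebra.ι K U u * g := by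
  let I : Ideal (SymmetricAlgebra K U) := Ideal.span {SymmetricAlgebra.ι K U u}
  -- The map ψ makes the quotient by the ideal (u) factor through Sym(U/⟨u⟩), so whatever dies there
  -- lies in (u).
  let ψ : (U ⧸ K ∙ u) →ₗ[K] (SymmetricAlgebra K U ⧸ I) :=
    (K ∙ u).liftQ ((Ideal.Quotient.mkₐ K I).toLinearMap.comp (SymmetricAlgebra.ι K U)) (by
      rw [Submodule.span_singleton_le_iff_mem, LinearMap.mem_ker]
      exact Ideal.Quotient.eq_zero_iff_mem.2 (Ideal.mem_span_singleton_self _))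
  have h : (SymmetricAlgebra.lift ψ).comp (symMap (K ∙ u).mkQ) = Ideal.Quotient.mkₐ K I := by
    ext v : 2
    simp [ψ]
  have h2 := DFunLike.congr_fun h f
  rw [AlgHom.comp_apply, hf, map_zero] at h2
  have h3 : f ∈ I := Ideal.Quotient.eq_zero_iff_mem.1 h2.symm
  exact (Ideal.mem_span_singleton.1 h3)

/-- The homomorphism `Sym(U) → Sym(U)[t]` with `u ↦ u + η(u) t`: translation in
direction `η`. -/
noncomputable def shift (η : U →ₗ[K] K) :
    SymmetricAlgebra K U →ₐ[K] Polynomial (SymmetricAlgebra K U) :=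
  SymmetricAlgebra.lift
    (Polynomial.CAlgHom.toLinearMap.comp (SymmetricAlgebra.ι K U) +
      η.smulRight (Polynomial.X : Polynomial (SymmetricAlgebra K U)))

theorem shift_ι (η : U →ₗ[K] K) (u : U) :
    shift η (SymmetricAlgebra.ι K U u) =
      Polynomial.C (SymmetricAlgebra.ι K U u) + η u • Polynomial.X := by
  simp [shift]

theorem shift_symMap (φ : U →ₗ[K] U') (η : U' →ₗ[K] K) (f : SymmetricAlgebra K U) :
    shift η (symMap φ f) = Polynomial.map (symMap φ).toRingHom (shift (η.comp φ) f) := by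
  have h : (shift η).comp (symMap φ) =
      (Polynomial.mapAlgHom (symMap φ)).comp (shift (η.comp φ)) := by
    ext u : 2
    simp [shift_ι, Algebra.smul_def]
  exact DFunLike.congr_fun h f

/-- The degree of `q` is less than the integer `e`. -/
def DegreeBelow {R : Type*} [Semiring R] (q : Polynomial R) (e : ℤ) : Prop :=
  ∀ j : ℕ, e ≤ j → q.coeff j = 0

section DegreeBelow

variable {R : Type*} [CommRing R] {p q : Polynomial R} {e e' : ℤ}

theorem DegreeBelow.mono (h : DegreeBelow q e) (he : e ≤ e') : DegreeBelow q e' :=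
  fun j hj => h j (he.trans hj)

theorem DegreeBelow.add (hp : DegreeBelow p e) (hq : DegreeBelow q e) :
    DegreeBelow (p + q) e := fun j hj => by
  rw [Polynomial.coeff_add, hp j hj, hq j hj, add_zero]

theorem degreeBelow_iff : DegreeBelow q e ↔ q = 0 ∨ (q.natDegree : ℤ) < e := by
  constructor
  · intro h
    by_contra! hcon
    exact hcon.1 (Polynomial.leadingCoeff_eq_zero.1 (h _ hcon.2))
  · rintro (rfl | h) j hj
    · simp
    · exact Polynomial.coeff_eq_zero_of_natDegree_lt (by omega)

theorem DegreeBelow.mul (hp : DegreeBelow p e) (hq : DegreeBelow q e') :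
    DegreeBelow (p * q) (e + e' - 1) := by
  rw [degreeBelow_iff] at hp hq ⊢
  rcases hp with rfl | hp
  · simp
  rcases hq with rfl | hq
  · simp
  right
  have := Polynomial.natDegree_mul_le (p := p) (q := q)
  omega

theorem degreeBelow_C (a : R) : DegreeBelow (Polynomial.C a) 1 := by
  rw [degreeBelow_iff]
  simp

end DegreeBelow

theorem degreeBelow_shift_ι (η : U →ₗ[K] K) (u : U) :
    DegreeBelow (shift η (SymmetricAlgebra.ι K U u)) 2 := by
  rw [shift_ι]
  intro j hj
  have : j ≠ 0 ∧ j ≠ 1 := by omega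
  rw [Polynomial.coeff_add, Polynomial.coeff_C, Polynomial.coeff_smul, Polynomial.coeff_X,
    if_neg this.1, if_neg this.2.symm, smul_zero, add_zero]

theorem degreeBelow_shift_ι_of_eq_zero (η : U →ₗ[K] K) (u : U) (hu : η u = 0) :
    DegreeBelow (shift η (SymmetricAlgebra.ι K U u)) 1 := by
  rw [shift_ι, hu, zero_smul, add_zero]
  exact degreeBelow_C _

theorem degreeBelow_shift_of_mem (η : U →ₗ[K] K) {n : ℕ} {f : SymmetricAlgebra K U}
    (hf : f ∈ symPiece K U n) : DegreeBelow (shift η f) (n + 1) := by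
  refine symPiece_induction (p := fun n f => DegreeBelow (shift η f) (n + 1)) ?_ ?_ ?_ hf
  · intro c
    rw [AlgHom.commutes]
    exact (degreeBelow_C _).mono (by simp)
  · intro n f g hf hg
    rw [map_add]
    exact hf.add hg
  · intro n u f hf
    rw [map_mul]
    exact ((degreeBelow_shift_ι η u).mul hf).mono (by push_cast; omega)

/-- Factors with index in C are unchanged by the translation; each of the others contributes at most
one to the degree. The bound is strict, hence the `+ 1`. -/
theorem degreeBelow_shift_pProd {ι : Type*} [DecidableEq ι] (η : U →ₗ[K] K) (x : ι → U)
    (Y C : Finset ι) (hC : ∀ c ∈ C, η (x c) = 0) :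
    DegreeBelow (shift η (pProd K x Y)) ((Y \ C).card + 1) := by
  induction Y using Finset.induction_on with
  | empty =>
    rw [pProd, Finset.prod_empty, map_one, ← Polynomial.C_1]
    exact (degreeBelow_C _).mono (by simp)
  | insert a s ha ih =>
    rw [pProd, Finset.prod_insert ha, map_mul]
    by_cases h : a ∈ C
    · refine ((degreeBelow_shift_ι_of_eq_zero η _ (hC a h)).mul ih).mono ?_
      rw [Finset.insert_sdiff_of_mem _ h]
      omega
    · refine ((degreeBelow_shift_ι η (x a)).mul ih).mono ?_
      rw [Finset.insert_sdiff_of_notMem _ h, Finset.card_insert_of_notMem (by simp [ha])]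
      push_cast
      omega

/-- Over the domain Sym(U) degrees in t add up, and the translate of u has degree exactly one
because its leading coefficient η(u) is nonzero. -/
theorem DegreeBelow.of_shift_ι_mul {η : U →ₗ[K] K} {u : U} (hu : η u ≠ 0)
    {f : SymmetricAlgebra K U} {e : ℤ}
    (h : DegreeBelow (shift η (SymmetricAlgebra.ι K U u * f)) (e + 1)) :
    DegreeBelow (shift η f) e := by
  have hdeg : (shift η (SymmetricAlgebra.ι K U u)).natDegree = 1 := by
    have : shift η (SymmetricAlgebra.ι K U u) =
        Polynomial.C (algebraMap K _ (η u)) * Polynomial.X +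
          Polynomial.C (SymmetricAlgebra.ι K U u) := by
      rw [shift_ι, add_comm, Algebra.smul_def]
      rfl
    rw [this]
    exact Polynomial.natDegree_linear (by simpa using hu)
  have hne : shift η (SymmetricAlgebra.ι K U u) ≠ 0 := by
    intro h0
    simp [h0] at hdeg
  rw [degreeBelow_iff, map_mul] at h
  rw [degreeBelow_iff]
  by_cases hf : shift η f = 0
  · exact Or.inl hf
  · right
    rw [Polynomial.natDegree_mul hne hf, hdeg] at h
    rcases h with h | h
    · exact absurd h (mul_ne_zero hne hf)
    · push_cast at h
      omega

/-- Here the translate of u is the nonzero constant u, which can be cancelled coefficient by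
coefficient. -/
theorem DegreeBelow.of_shift_ι_mul_of_eq_zero {η : U →ₗ[K] K} {u : U} (hu : η u = 0)
    (hu0 : u ≠ 0) {f : SymmetricAlgebra K U} {e : ℤ}
    (h : DegreeBelow (shift η (SymmetricAlgebra.ι K U u * f)) e) :
    DegreeBelow (shift η f) e := by
  intro j hj
  have := h j hj
  rw [map_mul, shift_ι, hu, zero_smul, add_zero, Polynomial.coeff_C_mul] at this
  exact (mul_eq_zero.1 this).resolve_left (ι_ne_zero hu0)

/-- The homomorphism `Sym(U) → Sym(U)[s][t]` with `u ↦ u + (η(u) + s η'(u)) t`. -/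
noncomputable def pencilShift (η η' : U →ₗ[K] K) :
    SymmetricAlgebra K U →ₐ[K] Polynomial (Polynomial (SymmetricAlgebra K U)) :=
  SymmetricAlgebra.lift (A := Polynomial (Polynomial (SymmetricAlgebra K U)))
    (Polynomial.CAlgHom.toLinearMap.comp
        (Polynomial.CAlgHom.toLinearMap.comp (SymmetricAlgebra.ι K U)) +
      η.smulRight (Polynomial.X : Polynomial (Polynomial (SymmetricAlgebra K U))) +
      η'.smulRight (Polynomial.C Polynomial.X * Polynomial.X :
        Polynomial (Polynomial (SymmetricAlgebra K U))))

theorem pencilShift_ι (η η' : U →ₗ[K] K) (u : U) :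
    pencilShift η η' (SymmetricAlgebra.ι K U u) =
      Polynomial.C (Polynomial.C (SymmetricAlgebra.ι K U u)) + η u • Polynomial.X +
        η' u • (Polynomial.C Polynomial.X * Polynomial.X) := by
  simp [pencilShift]

theorem shift_add_smul (η η' : U →ₗ[K] K) (s : K) (f : SymmetricAlgebra K U) :
    shift (η + s • η') f =
      Polynomial.map (Polynomial.evalRingHom (algebraMap K (SymmetricAlgebra K U) s))
        (pencilShift η η' f) := by
  induction f using SymmetricAlgebra.induction with
  | algebraMap r =>
    rw [AlgHom.commutes, AlgHom.commutes, Polynomial.algebraMap_apply,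
      Polynomial.algebraMap_apply, Polynomial.map_C, Polynomial.algebraMap_apply,
      Polynomial.coe_evalRingHom, Polynomial.eval_C]
  | ι u =>
    rw [shift_ι, pencilShift_ι]
    simp only [Algebra.smul_def, Polynomial.algebraMap_apply, LinearMap.add_apply,
      LinearMap.smul_apply, Algebra.algebraMap_self_apply, Polynomial.map_add, Polynomial.map_mul, Polynomial.map_C,
      Polynomial.map_X, Polynomial.coe_evalRingHom, Polynomial.eval_C, Polynomial.eval_X,
      map_add, map_mul]
    ring
  | mul a b ha hb => rw [map_mul, ha, hb, map_mul, Polynomial.map_mul]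
  | add a b ha hb => rw [map_add, ha, hb, map_add, Polynomial.map_add]

/-- The degree of `f` in direction `η` is at most its degree in the directions `η + s η'`,
for generic `s`. -/
theorem DegreeBelow.shift_of_forall_ne_zero [Infinite K] (η η' : U →ₗ[K] K)
    (f : SymmetricAlgebra K U) {e : ℤ}
    (h : ∀ s : K, s ≠ 0 → DegreeBelow (shift (η + s • η') f) e) :
    DegreeBelow (shift η f) e := by
  have hcoeff : ∀ (s : K) (j : ℕ), (shift (η + s • η') f).coeff j =
      ((pencilShift η η' f).coeff j).eval (algebraMap K (SymmetricAlgebra K U) s) := by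
    intro s j
    rw [shift_add_smul, Polynomial.coeff_map, Polynomial.coe_evalRingHom]
  intro j hj
  -- The coefficient of t^j is a polynomial in s that vanishes at infinitely many s, hence also at s
  -- = 0.
  have hzero : (pencilShift η η' f).coeff j = 0 := by
    refine Polynomial.eq_zero_of_infinite_isRoot _ ?_
    have hinf : Set.Infinite ((algebraMap K (SymmetricAlgebra K U)) '' {s : K | s ≠ 0}) :=
      Set.Infinite.image (fun a _ b _ hab => by simpa using hab)
        (Set.Finite.infinite_compl (Set.finite_singleton (0 : K)))
    refine hinf.mono ?_
    rintro _ ⟨s, hs, rfl⟩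
    exact (hcoeff s j).symm.trans (h s hs j hj)
  have := hcoeff 0 j
  rwa [zero_smul, add_zero, hzero, Polynomial.eval_zero] at this

end SymmetricAlgebra

/-! ### The spaces `zSpace` and `zKer`, and the admissible data. -/

section Spaces

variable {K : Type*} [Field K] {U : Type*} [AddCommGroup U] [Module K U]
  {ι : Type*}

/-- The span of the vectors `x i`, `i ∈ A`. -/
def spanOn (K : Type*) [Field K] {U : Type*} [AddCommGroup U] [Module K U] {ι : Type*}
    (x : ι → U) (A : Finset ι) : Submodule K U :=
  Submodule.span K (x '' A)

/-- The family `x` modulo the vector `x i`. -/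
def contractVec (K : Type*) [Field K] {U : Type*} [AddCommGroup U] [Module K U] {ι : Type*}
    (x : ι → U) (i : ι) (j : ι) : U ⧸ (K ∙ x i) :=
  (K ∙ x i).mkQ (x j)

theorem spanOn_mono (x : ι → U) {A B : Finset ι} (h : A ⊆ B) : spanOn K x A ≤ spanOn K x B :=
  Submodule.span_mono (Set.image_mono (by exact_mod_cast h))

theorem mem_spanOn (x : ι → U) {A : Finset ι} {i : ι} (h : i ∈ A) : x i ∈ spanOn K x A :=
  Submodule.subset_span ⟨i, h, rfl⟩

theorem spanOn_ne_top_of_dual {x : ι → U} {C : Finset ι} {η : U →ₗ[K] K} (hη : η ≠ 0)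
    (h : ∀ c ∈ C, η (x c) = 0) : spanOn K x C ≠ ⊤ := by
  intro htop
  apply hη
  have : spanOn K x C ≤ LinearMap.ker η := by
    refine Submodule.span_le.2 ?_
    rintro _ ⟨c, hc, rfl⟩
    exact h c hc
  rw [htop, top_le_iff] at this
  exact LinearMap.ker_eq_top.1 this

open Classical in
/-- The indicator function of `G`. -/
noncomputable def ind (G : Finset ι → Prop) (A : Finset ι) : ℤ := if G A then 1 else 0

theorem ind_nonneg (G : Finset ι → Prop) (A : Finset ι) : 0 ≤ ind G A := by
  unfold ind
  split_ifs <;> simp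

theorem ind_le_one (G : Finset ι → Prop) (A : Finset ι) : ind G A ≤ 1 := by
  unfold ind
  split_ifs <;> simp

theorem ind_of {G : Finset ι → Prop} {A : Finset ι} (h : G A) : ind G A = 1 := if_pos h

theorem ind_mono {G : Finset ι → Prop} {A B : Finset ι} (h : G A → G B) :
    ind G A ≤ ind G B := by
  by_cases hA : G A
  · rw [ind_of hA, ind_of (h hA)]
  · rw [ind, if_neg hA]
    exact ind_nonneg _ _

variable [DecidableEq ι]

theorem ind_contract (G : Finset ι → Prop) (i : ι) (A : Finset ι) :
    ind (fun A => G (insert i A)) A = ind G (insert i A) := rfl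

theorem pProd_insert (x : ι → U) {i : ι} {Y : Finset ι} (h : i ∉ Y) :
    pProd K x (insert i Y) = SymmetricAlgebra.ι K U (x i) * pProd K x Y :=
  Finset.prod_insert h

theorem spanOn_insert (x : ι → U) (i : ι) (A : Finset ι) :
    spanOn K x (insert i A) = (K ∙ x i) ⊔ spanOn K x A := by
  rw [spanOn, Finset.coe_insert, Set.image_insert_eq, Submodule.span_insert, spanOn]

theorem spanOn_insert_of_mem {x : ι → U} {i : ι} {A : Finset ι} (h : x i ∈ spanOn K x A) :
    spanOn K x (insert i A) = spanOn K x A := by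
  rw [spanOn_insert, sup_eq_right, Submodule.span_singleton_le_iff_mem]
  exact h

theorem comap_spanOn_contractVec (x : ι → U) (i : ι) (A : Finset ι) :
    (spanOn K (contractVec K x i) A).comap (K ∙ x i).mkQ = spanOn K x (insert i A) := by
  have : spanOn K (contractVec K x i) A = (spanOn K x A).map (K ∙ x i).mkQ := by
    rw [spanOn, spanOn, Submodule.map_span, Set.image_image]
    rfl
  rw [this, Submodule.comap_map_mkQ, spanOn_insert]

theorem spanOn_contractVec_le_iff (x : ι → U) (i : ι) (A B : Finset ι) :
    spanOn K (contractVec K x i) A ≤ spanOn K (contractVec K x i) B ↔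
      spanOn K x (insert i A) ≤ spanOn K x (insert i B) := by
  rw [← comap_spanOn_contractVec, ← comap_spanOn_contractVec,
    Submodule.comap_le_comap_iff_of_surjective (Submodule.mkQ_surjective _)]

theorem spanOn_contractVec_eq_top_iff (x : ι → U) (i : ι) (A : Finset ι) :
    spanOn K (contractVec K x i) A = ⊤ ↔ spanOn K x (insert i A) = ⊤ := by
  rw [← comap_spanOn_contractVec]
  constructor
  · intro h
    rw [h, Submodule.comap_top]
  · intro h
    rw [← Submodule.map_comap_eq_of_surjective (Submodule.mkQ_surjective (K ∙ x i))
      (spanOn K (contractVec K x i) A), h, Submodule.map_top, Submodule.range_mkQ]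

/-- Generators of the hierarchical zonotopal space of the subfamily `(x i)_{i ∈ E}`, with `ind G`
in place of the indicator function of an upper set of flats. -/
def zGenerators (K : Type*) [Field K] {U : Type*} [AddCommGroup U] [Module K U]
    (x : ι → U) (E : Finset ι) (k : ℤ) (G : Finset ι → Prop) : Set (SymmetricAlgebra K U) :=
  if k = -1 then
    {q | ∃ Y ⊆ E, (∀ C ⊆ E, spanOn K x C ≠ ⊤ →
      ((Y \ C).card : ℤ) < (E \ C).card - 1 + ind G C) ∧ q = pProd K x Y}
  else
    {q | ∃ Y ⊆ E, ∃ f ∈ symDegreeLE K U (ind G (E \ Y) + k - 1), q = f * pProd K x Y}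

/-- The hierarchical zonotopal space of the subfamily `(x i)_{i ∈ E}`. -/
def zSpace (K : Type*) [Field K] {U : Type*} [AddCommGroup U] [Module K U]
    (x : ι → U) (E : Finset ι) (k : ℤ) (G : Finset ι → Prop) :
    Submodule K (SymmetricAlgebra K U) :=
  Submodule.span K (zGenerators K x E k G)

/-- The inverse system of the power ideal that is dual to `zSpace`, described through degrees in
the directions `η`. -/
def zKer (K : Type*) [Field K] {U : Type*} [AddCommGroup U] [Module K U]
    (x : ι → U) (E : Finset ι) (k : ℤ) (G : Finset ι → Prop) :
    Submodule K (SymmetricAlgebra K U) where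
  carrier := {f | ∀ C ⊆ E, ∀ η : U →ₗ[K] K, η ≠ 0 → (∀ c ∈ C, η (x c) = 0) →
    DegreeBelow (shift η f) ((E \ C).card + k + ind G C)}
  add_mem' {f g} hf hg C hC η hη h := by
    rw [map_add]
    exact (hf C hC η hη h).add (hg C hC η hη h)
  zero_mem' C hC η hη h j hj := by
    rw [map_zero, Polynomial.coeff_zero]
  smul_mem' c f hf C hC η hη h j hj := by
    rw [map_smul, Polynomial.coeff_smul, hf C hC η hη h j hj, smul_zero]

/-- The hypotheses on the family `(x i)_{i ∈ E}`, on `k` and on `G`. -/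
structure Admissible (K : Type*) [Field K] {U : Type*} [AddCommGroup U] [Module K U]
    (x : ι → U) (E : Finset ι) (k : ℤ) (G : Finset ι → Prop) : Prop where
  spanning : spanOn K x E = ⊤
  le : -1 ≤ k
  mono : ∀ A B, spanOn K x A ≤ spanOn K x B → G A → G B
  ground : G E
  hyperplane : k = -1 → ∀ A ⊆ E, ∀ i ∈ E, spanOn K x A ≠ ⊤ → spanOn K x (insert i A) = ⊤ → G A

namespace Admissible

variable {x : ι → U} {E : Finset ι} {k : ℤ} {G : Finset ι → Prop}

theorem delete (h : Admissible K x E k G) {i : ι} (hi : spanOn K x (E.erase i) = ⊤) :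
    Admissible K x (E.erase i) k G where
  spanning := hi
  le := h.le
  mono := h.mono
  ground := h.mono _ _ (by rw [hi]; exact le_top) h.ground
  hyperplane hk A hA j hj := h.hyperplane hk A (hA.trans (Finset.erase_subset _ _)) j
    (Finset.mem_of_mem_erase hj)

/-- Spans of A modulo `x i` correspond to spans of `insert i A` in U, so every condition on the new
predicate is one on `G` at sets containing i. -/
theorem contract (h : Admissible K x E k G) {i : ι} (hi : i ∈ E) :
    Admissible K (contractVec K x i) (E.erase i) k (fun A => G (insert i A)) where
  spanning := by
    rw [spanOn_contractVec_eq_top_iff, Finset.insert_erase hi]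
    exact h.spanning
  le := h.le
  mono A B hAB := h.mono _ _ ((spanOn_contractVec_le_iff x i A B).1 hAB)
  ground := by
    rw [Finset.insert_erase hi]
    exact h.ground
  hyperplane hk A hA j hj h1 h2 := by
    rw [Ne, spanOn_contractVec_eq_top_iff] at h1
    rw [spanOn_contractVec_eq_top_iff, Finset.insert_comm] at h2
    exact h.hyperplane hk _
      (Finset.insert_subset hi (hA.trans (Finset.erase_subset _ _))) j
      (Finset.mem_of_mem_erase hj) h1 h2

theorem ind_mono (h : Admissible K x E k G) {A B : Finset ι}
    (hAB : spanOn K x A ≤ spanOn K x B) : ind G A ≤ ind G B :=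
  Zonotopal.ind_mono (h.mono A B hAB)

end Admissible

variable {x : ι → U} {E : Finset ι} {k : ℤ} {G : Finset ι → Prop}

/-- To check that `zSpace` lies in a subspace, it suffices to consider homogeneous generators. -/
theorem zSpace_le {W : Submodule K (SymmetricAlgebra K U)}
    (h1 : k = -1 → ∀ Y ⊆ E, (∀ C ⊆ E, spanOn K x C ≠ ⊤ →
      ((Y \ C).card : ℤ) < (E \ C).card - 1 + ind G C) → pProd K x Y ∈ W)
    (h2 : k ≠ -1 → ∀ Y ⊆ E, ∀ j : ℕ, (j : ℤ) ≤ ind G (E \ Y) + k - 1 →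
      ∀ f ∈ symPiece K U j, f * pProd K x Y ∈ W) : zSpace K x E k G ≤ W := by
  refine Submodule.span_le.2 fun q hq => ?_
  unfold zGenerators at hq
  split_ifs at hq with hk
  · obtain ⟨Y, hY, hC, rfl⟩ := hq
    exact h1 hk Y hY hC
  · obtain ⟨Y, hY, f, hf, rfl⟩ := hq
    have : symDegreeLE K U (ind G (E \ Y) + k - 1) ≤
        W.comap (LinearMap.mulRight K (pProd K x Y)) :=
      iSup₂_le fun j hj f hf => h2 hk Y hY j hj f hf
    exact this hf

theorem pProd_mem_zSpace (hk : k = -1) {Y : Finset ι} (hY : Y ⊆ E)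
    (h : ∀ C ⊆ E, spanOn K x C ≠ ⊤ → ((Y \ C).card : ℤ) < (E \ C).card - 1 + ind G C) :
    pProd K x Y ∈ zSpace K x E k G := by
  refine Submodule.subset_span ?_
  rw [zGenerators, if_pos hk]
  exact ⟨Y, hY, h, rfl⟩

theorem mul_pProd_mem_zSpace (hk : k ≠ -1) {Y : Finset ι} (hY : Y ⊆ E) {j : ℕ}
    (hj : (j : ℤ) ≤ ind G (E \ Y) + k - 1) {f : SymmetricAlgebra K U}
    (hf : f ∈ symPiece K U j) : f * pProd K x Y ∈ zSpace K x E k G := by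
  refine Submodule.subset_span ?_
  rw [zGenerators, if_neg hk]
  exact ⟨Y, hY, f, Submodule.mem_iSup_of_mem j (Submodule.mem_iSup_of_mem hj hf), rfl⟩

/-- The space is graded; this lets preimages of homogeneous elements be chosen homogeneous. -/
theorem symProj_mem_zSpace (d : ℕ) {f : SymmetricAlgebra K U} (hf : f ∈ zSpace K x E k G) :
    symProj K U d f ∈ zSpace K x E k G := by
  have : zSpace K x E k G ≤ (zSpace K x E k G).comap (symProj K U d) := by
    refine zSpace_le ?_ ?_
    · intro hk Y hY h
      rw [Submodule.mem_comap, symProj_of_mem (pProd_mem K x Y)]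
      split_ifs
      · exact pProd_mem_zSpace hk hY h
      · exact zero_mem _
    · intro hk Y hY j hj f hf
      rw [Submodule.mem_comap, symProj_of_mem (mul_mem_symPiece hf (pProd_mem K x Y))]
      split_ifs
      · exact mul_pProd_mem_zSpace hk hY hj hf
      · exact zero_mem _
  exact this hf

theorem card_sdiff_split {Y C E : Finset ι} (hY : Y ⊆ E) :
    E \ C ⊆ Y ∨ (Y \ C).card < (E \ C).card := by
  by_cases h : E \ C ⊆ Y
  · exact Or.inl h
  · right
    refine Finset.card_lt_card ⟨Finset.sdiff_subset_sdiff hY le_rfl, fun h' => h ?_⟩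
    exact h'.trans Finset.sdiff_subset

/-- Along η vanishing on C, the degree of f p_Y is at most deg f + |Y∖C|. For k = -1 the defining
inequality applies because a nonzero η that vanishes on C prevents C from spanning. -/
theorem zSpace_le_zKer (hA : Admissible K x E k G) : zSpace K x E k G ≤ zKer K x E k G := by
  refine zSpace_le ?_ ?_
  · intro hk Y hY h C hC η hη hηC
    refine (degreeBelow_shift_pProd η x Y C hηC).mono ?_
    have := h C hC (spanOn_ne_top_of_dual hη hηC)
    omega
  · intro hk Y hY j hj f hf C hC η hη hηC
    rw [map_mul]
    refine ((degreeBelow_shift_of_mem η hf).mul (degreeBelow_shift_pProd η x Y C hηC)).mono ?_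
    -- Either E∖Y ⊆ C, and monotonicity bounds the indicator at E∖Y by that at C; or |Y∖C| < |E∖C|,
    -- and this gain of one absorbs an indicator that is at most one.
    rcases card_sdiff_split (C := C) hY with h | h
    · have h1 : E \ Y ⊆ C := by
        intro e he
        rw [Finset.mem_sdiff] at he
        by_contra hc
        exact he.2 (h (Finset.mem_sdiff.2 ⟨he.1, hc⟩))
      have h2 := hA.ind_mono (spanOn_mono (K := K) x h1)
      have h3 := Finset.card_le_card (Finset.sdiff_subset_sdiff hY (le_refl C))
      omega
    · have h1 := ind_le_one G (E \ Y)
      have h2 := ind_nonneg G C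
      omega

/-! ### Behaviour of both spaces under deletion and contraction. -/

theorem sdiff_insert_erase {i : ι} (Y : Finset ι) : E \ insert i Y = E.erase i \ Y := by
  rw [Finset.sdiff_insert, Finset.erase_sdiff_comm]

theorem sdiff_erase_of_notMem {i : ι} {Y : Finset ι} (hi : i ∉ Y) (C : Finset ι) :
    Y \ C.erase i = Y \ C := by
  ext j
  grind

theorem erase_sdiff_erase_of_mem {i : ι} (E : Finset ι) {C : Finset ι} (hi : i ∈ C) :
    E.erase i \ C.erase i = E \ C := by
  ext j
  grind

theorem card_sdiff_of_notMem {i : ι} {C : Finset ι} (hi : i ∈ E) (hC : i ∉ C) :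
    (E \ C).card = (E.erase i \ C).card + 1 := by
  rw [← sdiff_insert_erase, Finset.sdiff_insert,
    Finset.card_erase_add_one (Finset.mem_sdiff.2 ⟨hi, hC⟩)]

/-- Multiplication by `x i` maps the space of the deletion into the space. -/
theorem ι_mul_mem_zSpace (hA : Admissible K x E k G) {i : ι} (hi : i ∈ E)
    {f : SymmetricAlgebra K U}
    (hf : f ∈ zSpace K x (E.erase i) k G) :
    SymmetricAlgebra.ι K U (x i) * f ∈ zSpace K x E k G := by
  have hins : ∀ Y ⊆ E.erase i, i ∉ Y ∧ insert i Y ⊆ E := fun Y hY =>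
    ⟨fun h => Finset.notMem_erase i E (hY h),
      Finset.insert_subset hi (hY.trans (Finset.erase_subset _ _))⟩
  have : zSpace K x (E.erase i) k G ≤ (zSpace K x E k G).comap
      (LinearMap.mulLeft K (SymmetricAlgebra.ι K U (x i))) := by
    refine zSpace_le ?_ ?_
    · intro hk Y hY h
      obtain ⟨hiY, hYE⟩ := hins Y hY
      rw [Submodule.mem_comap, LinearMap.mulLeft_apply, ← pProd_insert x hiY]
      refine pProd_mem_zSpace hk hYE fun C hC hCtop => ?_
      have hCi : spanOn K x (C.erase i) ≠ ⊤ := fun h' => hCtop (top_le_iff.1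
        (h' ▸ spanOn_mono x (Finset.erase_subset _ _)))
      have h1 := h (C.erase i) (Finset.erase_subset_erase i hC) hCi
      have h2 := hA.ind_mono (spanOn_mono (K := K) x (Finset.erase_subset i C))
      -- The inequality for `C.erase i` in the deletion suffices: if i ∈ C both cardinalities stay
      -- the same, otherwise both grow by one.
      by_cases hiC : i ∈ C
      · rw [Finset.insert_sdiff_of_mem _ hiC]
        have h3 : Y \ C = Y \ C.erase i := (sdiff_erase_of_notMem hiY C).symm
        have h4 : E \ C = E.erase i \ C.erase i := (erase_sdiff_erase_of_mem E hiC).symm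
        rw [h3, h4]
        omega
      · rw [Finset.erase_eq_of_notMem hiC] at h1
        rw [Finset.insert_sdiff_of_notMem _ hiC, Finset.card_insert_of_notMem
          (fun h' => hiY (Finset.mem_sdiff.1 h').1),
          card_sdiff_of_notMem hi hiC]
        push_cast
        omega
    · intro hk Y hY j hj f hf
      obtain ⟨hiY, hYE⟩ := hins Y hY
      rw [Submodule.mem_comap, LinearMap.mulLeft_apply, mul_left_comm,
        ← pProd_insert x hiY]
      exact mul_pProd_mem_zSpace hk hYE (by rwa [sdiff_insert_erase]) hf
  exact this hf

/-- The space of the contraction is contained in the image of the space. -/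
theorem zSpace_contract_le (hA : Admissible K x E k G) {i : ι} (hi : i ∈ E) :
    zSpace K (contractVec K x i) (E.erase i) k (fun A => G (insert i A)) ≤
      (zSpace K x E k G).map (symMap (K ∙ x i).mkQ).toLinearMap := by
  have hprod : ∀ Y, pProd K (contractVec K x i) Y = symMap (K ∙ x i).mkQ (pProd K x Y) :=
    fun Y => (symMap_pProd _ _ _).symm
  refine zSpace_le ?_ ?_
  · intro hk Y hY h
    have hiY : i ∉ Y := fun h => Finset.notMem_erase i E (hY h)
    have hYE : Y ⊆ E := hY.trans (Finset.erase_subset _ _)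
    refine ⟨pProd K x Y, pProd_mem_zSpace hk hYE fun C hC hCtop => ?_, (hprod Y).symm⟩
    by_cases hiC : i ∈ C
    · have h1 := h (C.erase i) (Finset.erase_subset_erase i hC) (by
        rwa [Ne, spanOn_contractVec_eq_top_iff, Finset.insert_erase hiC])
      have h2 : ind (fun A => G (insert i A)) (C.erase i) = ind G C := by
        rw [ind_contract, Finset.insert_erase hiC]
      have h3 : Y \ C = Y \ C.erase i := (sdiff_erase_of_notMem hiY C).symm
      have h4 : E \ C = E.erase i \ C.erase i := (erase_sdiff_erase_of_mem E hiC).symm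
      rw [h3, h4, ← h2]
      exact h1
    -- If `insert i C` spans, the contraction imposes nothing on C, but C spans a hyperplane and its
    -- indicator is one. Otherwise the contraction's inequality for C may use an indicator larger by
    -- one; the extra element i of E∖C compensates.
    · by_cases htop : spanOn K x (insert i C) = ⊤
      · rw [ind_of (hA.hyperplane hk C hC i hi hCtop htop)]
        have : Y \ C ⊆ E.erase i \ C := Finset.sdiff_subset_sdiff hY le_rfl
        have := Finset.card_le_card this
        rw [card_sdiff_of_notMem hi hiC]
        push_cast
        omega
      · have hCE : C ⊆ E.erase i := fun c hc =>
          Finset.mem_erase.2 ⟨fun h => hiC (h ▸ hc), hC hc⟩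
        have h1 := h C hCE (by rwa [Ne, spanOn_contractVec_eq_top_iff])
        have h2 := ind_le_one (fun A => G (insert i A)) C
        have h3 := ind_nonneg G C
        rw [card_sdiff_of_notMem hi hiC]
        push_cast
        omega
  · intro hk Y hY j hj f hf
    have hiY : i ∉ Y := fun h => Finset.notMem_erase i E (hY h)
    have hYE : Y ⊆ E := hY.trans (Finset.erase_subset _ _)
    rw [← map_symMap_symPiece (K ∙ x i).mkQ (Submodule.mkQ_surjective _)] at hf
    obtain ⟨g, hg, rfl⟩ := hf
    have h2 : ind (fun A => G (insert i A)) (E.erase i \ Y) = ind G (E \ Y) := by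
      have : insert i (E.erase i \ Y) = E \ Y := by grind
      rw [ind_contract, this]
    refine ⟨g * pProd K x Y, mul_pProd_mem_zSpace hk hYE (by rwa [← h2]) hg, ?_⟩
    rw [hprod Y]
    exact map_mul (symMap (K ∙ x i).mkQ) _ _

/-- The image of `zKer` is contained in `zKer` of the contraction. -/
theorem symMap_mem_zKer {i : ι} (hi : i ∈ E) {f : SymmetricAlgebra K U}
    (hf : f ∈ zKer K x E k G) :
    symMap (K ∙ x i).mkQ f ∈
      zKer K (contractVec K x i) (E.erase i) k (fun A => G (insert i A)) := by
  intro C hC η hη hηC j hj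
  rw [shift_symMap, Polynomial.coeff_map]
  have h0 : η.comp (K ∙ x i).mkQ ≠ 0 := by
    intro h
    apply hη
    ext u
    simpa using LinearMap.congr_fun h u
  have hvan : ∀ c ∈ insert i C, (η.comp (K ∙ x i).mkQ) (x c) = 0 := by
    intro c hc
    rcases Finset.mem_insert.1 hc with rfl | hc
    · rw [LinearMap.comp_apply, (Submodule.Quotient.mk_eq_zero (K ∙ x c)).2
        (Submodule.mem_span_singleton_self (x c)) |> (show (K ∙ x c).mkQ (x c) = 0 from ·), map_zero]
    · exact hηC c hc
  rw [hf (insert i C) (Finset.insert_subset hi (hC.trans (Finset.erase_subset _ _))) _ h0 hvan j,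
    map_zero]
  rwa [sdiff_insert_erase]

/-- If `x i * f` lies in `zKer`, then `f` lies in `zKer` of the deletion. -/
theorem mem_zKer_of_ι_mul_mem [Infinite K] (hA : Admissible K x E k G) {i : ι} (hi : i ∈ E)
    (hxi : x i ≠ 0) {f : SymmetricAlgebra K U}
    (hf : SymmetricAlgebra.ι K U (x i) * f ∈ zKer K x E k G) :
    f ∈ zKer K x (E.erase i) k G := by
  intro C hC η hη hηC
  have hCE : C ⊆ E := hC.trans (Finset.erase_subset _ _)
  have hiC : i ∉ C := fun h => Finset.notMem_erase i E (hC h)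
  -- If θ does not vanish at `x i`, dividing by `x i` lowers the degree by one, exactly the loss of
  -- i from E∖C.
  have key : ∀ θ : U →ₗ[K] K, (∀ c ∈ C, θ (x c) = 0) → θ (x i) ≠ 0 →
      DegreeBelow (shift θ f) ((E.erase i \ C).card + k + ind G C) := by
    intro θ hθC hθ
    refine DegreeBelow.of_shift_ι_mul hθ ?_
    refine (hf C hCE θ (fun h => hθ (by simp [h])) hθC).mono ?_
    rw [card_sdiff_of_notMem hi hiC]
    push_cast
    omega
  by_cases hηi : η (x i) = 0
  -- If `x i` lies in the span of C, the condition for `insert i C` already has the right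
  -- cardinality and the same indicator.
  · by_cases hmem : x i ∈ spanOn K x C
    · have hvan : ∀ c ∈ insert i C, η (x c) = 0 := by
        intro c hc
        rcases Finset.mem_insert.1 hc with rfl | hc
        exacts [hηi, hηC c hc]
      have h1 := (hf (insert i C) (Finset.insert_subset hi hCE) η hη
        hvan).of_shift_ι_mul_of_eq_zero hηi hxi
      rw [sdiff_insert_erase] at h1
      exact h1.mono (by
        have := hA.ind_mono (spanOn_insert_of_mem hmem).le
        omega)
    · obtain ⟨θ, hθ, hθC⟩ := Submodule.exists_le_ker_of_notMem hmem
      have hθC' : ∀ c ∈ C, θ (x c) = 0 := fun c hc => hθC (mem_spanOn x hc)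
      refine DegreeBelow.shift_of_forall_ne_zero η θ f fun s hs => key _ ?_ ?_
      · intro c hc
        simp [hηC c hc, hθC' c hc]
      · simp [hηi, hs, hθ]
  · exact key η hηC hηi

/-- Removing a loop does not shrink `zKer`. -/
theorem zKer_le_erase_of_eq_zero (hA : Admissible K x E k G) {i : ι} (hi : i ∈ E)
    (hxi : x i = 0) : zKer K x E k G ≤ zKer K x (E.erase i) k G := by
  intro f hf C hC η hη hηC
  have hvan : ∀ c ∈ insert i C, η (x c) = 0 := by
    intro c hc
    rcases Finset.mem_insert.1 hc with rfl | hc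
    exacts [by rw [hxi, map_zero], hηC c hc]
  refine (hf (insert i C) (Finset.insert_subset hi (hC.trans (Finset.erase_subset _ _))) η hη
    hvan).mono ?_
  rw [sdiff_insert_erase]
  have := hA.ind_mono (spanOn_insert_of_mem (x := x) (i := i) (A := C)
    (by rw [hxi]; exact zero_mem _)).le
  omega

/-- Deletion does not enlarge `zSpace`. -/
theorem zSpace_erase_le (hA : Admissible K x E k G) (i : ι) :
    zSpace K x (E.erase i) k G ≤ zSpace K x E k G := by
  refine zSpace_le ?_ ?_
  · intro hk Y hY h
    have hiY : i ∉ Y := fun h => Finset.notMem_erase i E (hY h)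
    refine pProd_mem_zSpace hk (hY.trans (Finset.erase_subset _ _)) fun C hC hCtop => ?_
    have hCi : spanOn K x (C.erase i) ≠ ⊤ := fun h' => hCtop (top_le_iff.1
      (h' ▸ spanOn_mono x (Finset.erase_subset _ _)))
    have h1 := h (C.erase i) (Finset.erase_subset_erase i hC) hCi
    have h2 := hA.ind_mono (spanOn_mono (K := K) x (Finset.erase_subset i C))
    have h3 : Y \ C = Y \ C.erase i := (sdiff_erase_of_notMem hiY C).symm
    have h4 : E.erase i \ C.erase i ⊆ E \ C := by grind
    have h5 := Finset.card_le_card h4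
    rw [h3]
    omega
  · intro hk Y hY j hj f hf
    refine mul_pProd_mem_zSpace hk (hY.trans (Finset.erase_subset _ _)) (hj.trans ?_) hf
    have : E.erase i \ Y ⊆ E \ Y := Finset.sdiff_subset_sdiff (Finset.erase_subset _ _) le_rfl
    have := hA.ind_mono (spanOn_mono (K := K) x this)
    omega

end Spaces

/-! ### The case of a basis: monomials. -/

section Boolean

variable {K : Type*} [Field K] {U : Type*} [AddCommGroup U] [Module K U]

section Monomials

variable {κ : Type*} (b : Module.Basis κ K U)

theorem symmetricAlgebra_zero : b.symmetricAlgebra 0 = 1 := by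
  simp [Module.Basis.symmetricAlgebra]

theorem symmetricAlgebra_add (a a' : κ →₀ ℕ) :
    b.symmetricAlgebra (a + a') = b.symmetricAlgebra a * b.symmetricAlgebra a' := by
  simp only [Module.Basis.symmetricAlgebra, Module.Basis.map_apply,
    MvPolynomial.coe_basisMonomials, AlgEquiv.toLinearEquiv_apply]
  rw [← map_mul, MvPolynomial.monomial_mul, one_mul]

theorem symmetricAlgebra_single (e : κ) :
    b.symmetricAlgebra (Finsupp.single e 1) = SymmetricAlgebra.ι K U (b e) := by
  simp only [Module.Basis.symmetricAlgebra, Module.Basis.map_apply,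
    MvPolynomial.coe_basisMonomials, AlgEquiv.toLinearEquiv_apply]
  exact SymmetricAlgebra.equivMvPolynomial_symm_X b e

theorem symmetricAlgebra_sum_single (S : Finset κ) :
    b.symmetricAlgebra (∑ e ∈ S, Finsupp.single e 1) =
      ∏ e ∈ S, SymmetricAlgebra.ι K U (b e) := by
  classical
  induction S using Finset.induction_on with
  | empty => rw [Finset.sum_empty, Finset.prod_empty, symmetricAlgebra_zero]
  | insert a s ha ih =>
    rw [Finset.sum_insert ha, Finset.prod_insert ha, symmetricAlgebra_add, ih,
      symmetricAlgebra_single]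

theorem symmetricAlgebra_mem_symPiece (a : κ →₀ ℕ) :
    b.symmetricAlgebra a ∈ symPiece K U a.degree := by
  induction a using Finsupp.induction_linear with
  | zero =>
    rw [symmetricAlgebra_zero, map_zero, symPiece, pow_zero]
    exact Submodule.one_le.1 le_rfl
  | add f g hf hg =>
    rw [symmetricAlgebra_add, map_add]
    exact mul_mem_symPiece hf hg
  | single e n =>
    induction n with
    | zero =>
      rw [Finsupp.single_zero, symmetricAlgebra_zero, map_zero, symPiece, pow_zero]
      exact Submodule.one_le.1 le_rfl
    | succ n ih =>
      rw [Finsupp.single_add, symmetricAlgebra_add, map_add, symmetricAlgebra_single,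
        Finsupp.degree_single e 1]
      exact mul_mem_symPiece ih (ι_mem_symPiece_one _)

/-- Monomials are homogeneous, so the projection keeps exactly the coefficients of degree d; a
graded piece of a span of monomials is thus again spanned by monomials. -/
theorem repr_symProj (d : ℕ) (f : SymmetricAlgebra K U) (a : κ →₀ ℕ) :
    b.symmetricAlgebra.repr (symProj K U d f) a =
      if a.degree = d then b.symmetricAlgebra.repr f a else 0 := by
  have h : (Finsupp.lapply a).comp
        (b.symmetricAlgebra.repr.toLinearMap.comp (symProj K U d)) =
      if a.degree = d then (Finsupp.lapply a).comp b.symmetricAlgebra.repr.toLinearMap else 0 := by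
    refine b.symmetricAlgebra.ext fun a' => ?_
    simp only [LinearMap.comp_apply, LinearEquiv.coe_coe, Finsupp.lapply_apply]
    rw [symProj_of_mem (symmetricAlgebra_mem_symPiece b a')]
    by_cases h : a' = a
    · subst h
      by_cases hd : a'.degree = d
      · simp [hd]
      · simp [hd, Ne.symm hd]
    · split_ifs <;> simp [h]
  have := LinearMap.congr_fun h f
  split_ifs at this ⊢ <;> exact this

theorem span_monomials_inf_symPiece (A : Set (κ →₀ ℕ)) (d : ℕ) :
    Submodule.span K (b.symmetricAlgebra '' A) ⊓ symPiece K U d =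
      Submodule.span K (b.symmetricAlgebra '' {a ∈ A | a.degree = d}) := by
  apply le_antisymm
  · rintro f ⟨hf, hd⟩
    rw [SetLike.mem_coe, Module.Basis.mem_span_image] at hf
    rw [Module.Basis.mem_span_image]
    intro a ha
    refine ⟨hf ha, ?_⟩
    by_contra hne
    have := repr_symProj b d f a
    rw [mem_symPiece_iff.1 hd, if_neg hne] at this
    exact Finsupp.mem_support_iff.1 ha this
  · refine Submodule.span_le.2 ?_
    rintro _ ⟨a, ⟨ha, rfl⟩, rfl⟩
    exact ⟨Submodule.subset_span ⟨a, ha, rfl⟩, symmetricAlgebra_mem_symPiece b a⟩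

theorem finrank_span_monomials (A : Set (κ →₀ ℕ)) :
    Module.finrank K (Submodule.span K (b.symmetricAlgebra '' A)) = Nat.card A := by
  have hli : LinearIndependent K (fun a : A => b.symmetricAlgebra a) :=
    b.symmetricAlgebra.linearIndependent.comp _ Subtype.val_injective
  rw [Module.finrank_eq_nat_card_basis (Module.Basis.span hli |>.map
    (LinearEquiv.ofEq _ _ (by rw [Set.image_eq_range])))]

end Monomials

section Coefficients

variable {κ : Type*}

theorem coeff_aeval_C_mul_X (y : κ → K) (F : MvPolynomial κ K) (j : ℕ) :
    (MvPolynomial.aeval (fun e => Polynomial.C (y e) * Polynomial.X) F).coeff j =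
      MvPolynomial.eval y (MvPolynomial.homogeneousComponent j F) := by
  induction F using MvPolynomial.induction_on' with
  | monomial a c =>
    have h : MvPolynomial.aeval (fun e => Polynomial.C (y e) * Polynomial.X)
        (MvPolynomial.monomial a c) =
          Polynomial.C (c * a.prod fun e n => y e ^ n) * Polynomial.X ^ a.degree := by
      rw [MvPolynomial.aeval_monomial, Finsupp.prod, Finsupp.prod, map_mul, map_prod,
        Finsupp.degree_apply, mul_assoc, ← Finset.prod_pow_eq_pow_sum, ← Finset.prod_mul_distrib]
      simp [mul_pow]
    rw [h, Polynomial.coeff_C_mul_X_pow, MvPolynomial.homogeneousComponent_of_mem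
      (MvPolynomial.isHomogeneous_monomial c rfl)]
    split_ifs
    · rw [MvPolynomial.eval_monomial]
    · rw [map_zero]
  | add p q hp hq => rw [map_add, Polynomial.coeff_add, hp, hq, map_add, map_add]

open Classical in
theorem coeff_aeval_ite_X (S : Finset κ) (a : κ →₀ ℕ) (ha : a.support ⊆ S)
    (F : MvPolynomial κ K) :
    (MvPolynomial.aeval (fun e => if e ∈ S then MvPolynomial.X e else 0) F :
      MvPolynomial κ K).coeff a = F.coeff a := by
  induction F using MvPolynomial.induction_on' with
  | monomial a' c =>
    by_cases h : a'.support ⊆ S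
    · have : MvPolynomial.aeval (fun e => if e ∈ S then MvPolynomial.X e else 0)
          (MvPolynomial.monomial a' c) = (MvPolynomial.monomial a' c : MvPolynomial κ K) := by
        rw [MvPolynomial.aeval_monomial, MvPolynomial.monomial_eq]
        congr 1
        exact Finset.prod_congr rfl fun e he => by
          dsimp only
          rw [if_pos (h he)]
      rw [this]
    · obtain ⟨e, he, heS⟩ := Finset.not_subset.1 h
      have : MvPolynomial.aeval (fun e => if e ∈ S then MvPolynomial.X e else 0)
          (MvPolynomial.monomial a' c) = (0 : MvPolynomial κ K) := by
        rw [MvPolynomial.aeval_monomial, Finsupp.prod, Finset.prod_eq_zero he, mul_zero]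
        rw [if_neg heS, zero_pow (Finsupp.mem_support_iff.1 he)]
      rw [this, MvPolynomial.coeff_zero, MvPolynomial.coeff_monomial, if_neg]
      rintro rfl
      exact h ha
  | add p q hp hq => rw [map_add, MvPolynomial.coeff_add, hp, hq, MvPolynomial.coeff_add]

/-- Setting the variables outside the support of a to zero keeps the coefficient at a, and the
specialised polynomial vanishes at every point of an infinite field. -/
theorem coeff_eq_zero_of_eval_eq_zero [Infinite K] (F : MvPolynomial κ K) (a : κ →₀ ℕ)
    (h : ∀ y : κ → K, (∀ e ∉ a.support, y e = 0) → MvPolynomial.eval y F = 0) :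
    F.coeff a = 0 := by
  classical
  rw [← coeff_aeval_ite_X a.support a le_rfl F]
  have : MvPolynomial.aeval (fun e => if e ∈ a.support then MvPolynomial.X e else 0) F =
      (0 : MvPolynomial κ K) := by
    refine MvPolynomial.funext fun y => ?_
    rw [map_zero, ← h (fun e => if e ∈ a.support then y e else 0) (fun e he => if_neg he)]
    have := DFunLike.congr_fun (MvPolynomial.comp_aeval (R := K)
      (fun e => if e ∈ a.support then MvPolynomial.X e else 0) (MvPolynomial.aeval y)) F
    rw [AlgHom.comp_apply] at this
    simp only [MvPolynomial.aeval_eq_eval] at this ⊢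
    refine this.trans ?_
    congr 2
    ext e
    split_ifs <;> simp
  rw [this, MvPolynomial.coeff_zero]

/-- The augmentation sends each u to 0, so the translate becomes the restriction of f to the line
tη, with y the values of η on the basis. -/
theorem mapAlgHom_algebraMapInv_shift (b : Module.Basis κ K U) (y : κ → K)
    (f : SymmetricAlgebra K U) :
    Polynomial.map (SymmetricAlgebra.algebraMapInv (R := K) (M := U)).toRingHom
        (shift (b.constr K y) f) =
      MvPolynomial.aeval (fun e => Polynomial.C (y e) * Polynomial.X)
        (SymmetricAlgebra.equivMvPolynomial b f) := by
  have h : (Polynomial.mapAlgHom (SymmetricAlgebra.algebraMapInv (R := K) (M := U))).comp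
      (shift (b.constr K y)) =
      (MvPolynomial.aeval (fun e => Polynomial.C (y e) * Polynomial.X)).comp
        (SymmetricAlgebra.equivMvPolynomial b).toAlgHom := by
    refine SymmetricAlgebra.algHom_ext (b.ext fun e => ?_)
    simp [shift_ι, SymmetricAlgebra.algebraMapInv_ι, Algebra.smul_def]
  exact DFunLike.congr_fun h f

end Coefficients

theorem map_subtype_subset {ι : Type*} {E : Finset ι} (S : Finset E) :
    S.map (Function.Embedding.subtype (· ∈ E)) ⊆ E := by
  intro i hi
  obtain ⟨e, -, rfl⟩ := Finset.mem_map.1 hi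
  exact e.2

variable {ι : Type*} [DecidableEq ι]

/-- The exponents of the monomials in the space of a basis. -/
def zExponents (E : Finset ι) (k : ℤ) (G : Finset ι → Prop) : Set (E →₀ ℕ) :=
  {a | a = 0 ∨ (a.degree : ℤ) < a.support.card + k +
    ind G (E \ a.support.map (Function.Embedding.subtype (· ∈ E)))}

variable {x : ι → U} {E : Finset ι} {k : ℤ} {G : Finset ι → Prop}

theorem symmetricAlgebra_mem_zSpace (hA : Admissible K x E k G) (b : Module.Basis E K U)
    (hb : ∀ e, b e = x e) {a : E →₀ ℕ} (ha : a ∈ zExponents E k G) :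
    b.symmetricAlgebra a ∈ zSpace K x E k G := by
  have hsub : ∑ e ∈ a.support, Finsupp.single e 1 ≤ a := by
    intro e
    rw [Finsupp.finsetSum_apply]
    by_cases he : e ∈ a.support
    · rw [Finset.sum_eq_single_of_mem e he
        (fun e' _ h => Finsupp.single_eq_of_ne (Ne.symm h)), Finsupp.single_eq_same]
      exact Nat.one_le_iff_ne_zero.2 (Finsupp.mem_support_iff.1 he)
    · rw [Finset.sum_eq_zero fun e' he' => by
        rw [Finsupp.single_apply, if_neg]
        rintro rfl
        exact he he']
      exact Nat.zero_le _
  -- The square-free part of the monomial is p_Y with Y the support of a; a' is the exponent of the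
  -- cofactor f.
  obtain ⟨a', ha'⟩ := exists_add_of_le hsub
  have hdeg : a.degree = a.support.card + a'.degree := by
    conv_lhs => rw [ha']
    simp
  by_cases hk : k = -1
  -- The degree of a is at least the size of its support, so for k = -1 the strict inequality never
  -- holds and only the constant 1 remains. This is why 0 is listed separately in `zExponents`.
  · have ha0 : a = 0 := by
      rcases ha with h | h
      · exact h
      · have := ind_le_one G (E \ a.support.map (Function.Embedding.subtype (· ∈ E)))
        omega
    have h1 : b.symmetricAlgebra a = pProd K x ∅ := by
      rw [ha0, symmetricAlgebra_zero, pProd, Finset.prod_empty]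
    rw [h1]
    refine pProd_mem_zSpace hk (Finset.empty_subset _) fun C hC hCtop => ?_
    rw [Finset.empty_sdiff, Finset.card_empty]
    obtain ⟨i, hi⟩ : (E \ C).Nonempty := by
      rw [Finset.sdiff_nonempty]
      exact fun h => hCtop (top_le_iff.1 (hA.spanning ▸ spanOn_mono x h))
    have hpos : 0 < (E \ C).card := Finset.card_pos.2 ⟨i, hi⟩
    have hnn := ind_nonneg G C
    -- When |E∖C| = 1, the set C spans a hyperplane and its indicator supplies the missing one.
    by_cases h1 : (E \ C).card = 1
    · have hE : insert i C = E := by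
        obtain ⟨i', hi'⟩ := Finset.card_eq_one.1 h1
        have hii' : i = i' := Finset.mem_singleton.1 (hi' ▸ hi)
        rw [← Finset.sdiff_union_of_subset hC, hi', hii', Finset.insert_eq]
      rw [ind_of (hA.hyperplane hk C hC i (Finset.mem_sdiff.1 hi).1 hCtop
        (by rw [hE]; exact hA.spanning))]
      push_cast
      omega
    · push_cast
      omega
  · have hprod : b.symmetricAlgebra a = b.symmetricAlgebra a' *
        pProd K x (a.support.map (Function.Embedding.subtype (· ∈ E))) := by
      conv_lhs => rw [ha']
      rw [symmetricAlgebra_add, symmetricAlgebra_sum_single, mul_comm, pProd, Finset.prod_map]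
      simp [hb]
    rw [hprod]
    refine mul_pProd_mem_zSpace hk (map_subtype_subset _) ?_ (symmetricAlgebra_mem_symPiece b a')
    rcases ha with h | h
    · have : a'.degree = 0 := by
        have : a.degree = 0 := by rw [h, map_zero]
        omega
      rw [h, this]
      simp only [Finsupp.support_zero, Finset.map_empty, Finset.sdiff_empty, ind_of hA.ground]
      have := hA.le
      push_cast
      omega
    · push_cast [hdeg] at h
      omega

/-- The coefficient at a is tested on functionals η supported on the support Y of a. These vanish on
C = E∖Y, so |E∖C| is the size of the support, and the degree bound kills the degree |a| part of f on
all such η when a is not an allowed exponent. -/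
theorem zKer_le_span [Infinite K] (b : Module.Basis E K U)
    (hb : ∀ e, b e = x e) :
    zKer K x E k G ≤ Submodule.span K (b.symmetricAlgebra '' zExponents E k G) := by
  intro f hf
  rw [Module.Basis.mem_span_image]
  intro a ha
  have hacoeff : (SymmetricAlgebra.equivMvPolynomial b f).coeff a ≠ 0 :=
    Finsupp.mem_support_iff.1 ha
  by_contra hnot
  simp only [zExponents, Set.mem_ofPred_eq, not_or, not_lt] at hnot
  obtain ⟨ha0, hle⟩ := hnot
  have hdpos : a.degree ≠ 0 := by simpa [Finsupp.degree_eq_zero_iff] using ha0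
  set Y := a.support.map (Function.Embedding.subtype (· ∈ E)) with hY
  apply hacoeff
  have hF : (SymmetricAlgebra.equivMvPolynomial b f).coeff a =
      (MvPolynomial.homogeneousComponent a.degree
        (SymmetricAlgebra.equivMvPolynomial b f)).coeff a := by
    rw [MvPolynomial.coeff_homogeneousComponent, if_pos rfl]
  rw [hF]
  refine coeff_eq_zero_of_eval_eq_zero _ a fun y hy => ?_
  rw [← coeff_aeval_C_mul_X, ← mapAlgHom_algebraMapInv_shift]
  -- The conditions in `zKer` exclude η = 0; there a homogeneous component of positive degree
  -- vanishes anyway.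
  by_cases hy0 : b.constr K y = 0
  · have : y = 0 := (b.constr K).map_eq_zero_iff.1 hy0
    subst this
    rw [mapAlgHom_algebraMapInv_shift, coeff_aeval_C_mul_X]
    change MvPolynomial.eval (fun _ => 0) _ = 0
    rw [MvPolynomial.eval_zero', MvPolynomial.constantCoeff_eq,
      MvPolynomial.coeff_homogeneousComponent, if_neg (by simpa using hdpos.symm)]
  · rw [Polynomial.coeff_map, hf (E \ Y) Finset.sdiff_subset _ hy0 ?_ a.degree ?_, map_zero]
    · intro c hc
      rw [Finset.mem_sdiff] at hc
      have := hb ⟨c, hc.1⟩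
      rw [← this, Module.Basis.constr_basis]
      refine hy _ fun h => hc.2 ?_
      rw [hY]
      exact Finset.mem_map.2 ⟨_, h, rfl⟩
    · rw [Finset.sdiff_sdiff_eq_self (map_subtype_subset _), hY, Finset.card_map]
      exact hle

/-- For a basis, the space is spanned by monomials. -/
theorem zSpace_eq_span_of_basis [Infinite K] (hA : Admissible K x E k G)
    (b : Module.Basis E K U) (hb : ∀ e, b e = x e) :
    zSpace K x E k G = Submodule.span K (b.symmetricAlgebra '' zExponents E k G) := by
  refine le_antisymm ((zSpace_le_zKer hA).trans (zKer_le_span b hb)) (Submodule.span_le.2 ?_)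
  rintro _ ⟨a, ha, rfl⟩
  exact symmetricAlgebra_mem_zSpace hA b hb ha

theorem exists_basis_of_notMem_span (hspan : spanOn K x E = ⊤)
    (h : ∀ i ∈ E, x i ∉ spanOn K x (E.erase i)) : ∃ b : Module.Basis E K U, ∀ e, b e = x e := by
  have hli : LinearIndependent K (fun e : E => x e) := by
    rw [linearIndependent_iff_notMem_span]
    intro e he
    refine h e e.2 (Submodule.span_mono ?_ he)
    rintro _ ⟨e', he', rfl⟩
    refine ⟨e', ?_, rfl⟩
    rw [Finset.mem_coe, Finset.mem_erase]
    exact ⟨fun h => he'.2 (Subtype.ext h), e'.2⟩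
  have htop : ⊤ ≤ Submodule.span K (Set.range fun e : E => x e) := by
    rw [← hspan, spanOn, Set.image_eq_range]
    exact le_rfl
  exact ⟨Module.Basis.mk hli htop, fun e => Module.Basis.mk_apply hli htop e⟩

end Boolean

/-! ### Equality of the two descriptions by deletion and contraction. -/

section DeletionContraction

universe u v w w'

variable {K : Type v} [Field K] {ι : Type*} [DecidableEq ι]

theorem spanOn_erase_eq_top {U : Type*} [AddCommGroup U] [Module K U] {x : ι → U} {E : Finset ι}
    {i : ι} (hi : i ∈ E) (hmem : x i ∈ spanOn K x (E.erase i)) (hE : spanOn K x E = ⊤) :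
    spanOn K x (E.erase i) = ⊤ := by
  rw [← spanOn_insert_of_mem hmem, Finset.insert_erase hi, hE]

/-- The space generated by products is the inverse system of the power ideal. -/
theorem zSpace_eq_zKer [Infinite K] {k : ℤ} {U : Type u} [AddCommGroup U] [Module K U]
    {x : ι → U} {E : Finset ι} {G : Finset ι → Prop}
    (hA : Admissible K x E k G) : zSpace K x E k G = zKer K x E k G := by
  refine le_antisymm (zSpace_le_zKer hA) ?_
  -- The space U and the predicate must vary, since contraction changes both.
  have aux : ∀ (n : ℕ) (U : Type u) [AddCommGroup U] [Module K U] (x : ι → U) (E : Finset ι)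
      (G : Finset ι → Prop), E.card = n → Admissible K x E k G →
        zKer K x E k G ≤ zSpace K x E k G := by
    intro n
    induction n with
    | zero =>
      intro U _ _ x E G hE hA
      obtain ⟨b, hb⟩ := exists_basis_of_notMem_span hA.spanning
        (by simp [Finset.card_eq_zero.1 hE])
      rw [zSpace_eq_span_of_basis hA b hb]
      exact zKer_le_span b hb
    | succ n ih =>
      intro U _ _ x E G hE hA
      by_cases h : ∃ i ∈ E, x i ∈ spanOn K x (E.erase i)
      · obtain ⟨i, hi, hmem⟩ := h
        have hspan := spanOn_erase_eq_top hi hmem hA.spanning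
        have hcard : (E.erase i).card = n := by rw [Finset.card_erase_of_mem hi, hE]; rfl
        have hdel := ih U x (E.erase i) G hcard (hA.delete hspan)
        by_cases hxi : x i = 0
        · exact (zKer_le_erase_of_eq_zero hA hi hxi).trans
            (hdel.trans (zSpace_erase_le hA i))
        · intro f hf
          -- The image of f lies in the space of the contraction by induction and lifts to p. The
          -- difference f - p is `x i` times some g, and g satisfies the conditions of the deletion,
          -- where induction applies again.
          obtain ⟨p, hp, hpf⟩ := zSpace_contract_le hA hi
            (ih _ _ _ _ hcard (hA.contract hi) (symMap_mem_zKer hi hf))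
          obtain ⟨g, hg⟩ := exists_eq_ι_mul_of_symMap_mkQ_eq_zero (x i) (f - p) (by
            rw [map_sub, sub_eq_zero]
            exact hpf.symm)
          have hg' : SymmetricAlgebra.ι K U (x i) * g ∈ zKer K x E k G :=
            hg ▸ sub_mem hf (zSpace_le_zKer hA hp)
          have := ι_mul_mem_zSpace hA hi (hdel (mem_zKer_of_ι_mul_mem hA hi hxi hg'))
          rw [← sub_add_cancel f p, hg]
          exact add_mem this hp
      · push Not at h
        obtain ⟨b, hb⟩ := exists_basis_of_notMem_span hA.spanning h
        rw [zSpace_eq_span_of_basis hA b hb]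
        exact zKer_le_span b hb
  exact aux _ U x E G rfl hA

theorem symMap_ι_mul_eq_zero {U : Type*} [AddCommGroup U] [Module K U] (u : U) (g : SymmetricAlgebra K U) :
    symMap (K ∙ u).mkQ (SymmetricAlgebra.ι K U u * g) = 0 := by
  have : (K ∙ u).mkQ u = 0 := (Submodule.Quotient.mk_eq_zero _).2
    (Submodule.mem_span_singleton_self u)
  rw [map_mul, symMap_ι, this, map_zero, zero_mul]

theorem finrank_map_add_finrank_inf_ker {V V' : Type*} [AddCommGroup V] [Module K V]
    [AddCommGroup V'] [Module K V'] (φ : V →ₗ[K] V') (W : Submodule K V)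
    [FiniteDimensional K W] :
    Module.finrank K (W.map φ) + Module.finrank K ↥(W ⊓ LinearMap.ker φ) =
      Module.finrank K W := by
  rw [← LinearMap.finrank_range_add_finrank_ker (φ.domRestrict W), LinearMap.range_domRestrict,
    LinearMap.ker_domRestrict]
  congr 1
  rw [← Submodule.map_comap_subtype]
  exact (Submodule.equivMapOfInjective W.subtype (Submodule.subtype_injective W)
    ((LinearMap.ker φ).comap W.subtype)).finrank_eq.symm

/-! ### The exact sequence and the recursion for graded dimensions. -/

section Recursion

variable [Infinite K] {k : ℤ} {U : Type*} [AddCommGroup U] [Module K U]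
    {x : ι → U} {E : Finset ι} {G : Finset ι → Prop}

theorem zSpace_erase_eq_of_eq_zero (hA : Admissible K x E k G) {i : ι} (hi : i ∈ E)
    (hxi : x i = 0) : zSpace K x (E.erase i) k G = zSpace K x E k G := by
  have hdel := hA.delete (i := i)
    (spanOn_erase_eq_top hi (by rw [hxi]; exact zero_mem _) hA.spanning)
  refine le_antisymm (zSpace_erase_le hA i) ?_
  rw [zSpace_eq_zKer hdel]
  exact (zSpace_le_zKer hA).trans (zKer_le_erase_of_eq_zero hA hi hxi)

/-- The inclusion from left to right rests on the conditions `zKer`, the converse on lifting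
generators and then projecting the lift to degree d. -/
theorem map_zSpace_inf_symPiece (hA : Admissible K x E k G) {i : ι} (hi : i ∈ E) (d : ℕ) :
    (zSpace K x E k G ⊓ symPiece K U d).map (symMap (K ∙ x i).mkQ).toLinearMap =
      zSpace K (contractVec K x i) (E.erase i) k (fun A => G (insert i A)) ⊓
        symPiece K (U ⧸ (K ∙ x i)) d := by
  apply le_antisymm
  · rintro _ ⟨f, ⟨hf, hd⟩, rfl⟩
    refine ⟨?_, ?_⟩
    · rw [SetLike.mem_coe, zSpace_eq_zKer (hA.contract hi)]
      exact symMap_mem_zKer hi (zSpace_le_zKer hA hf)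
    · rw [← map_symMap_symPiece _ (Submodule.mkQ_surjective (K ∙ x i))]
      exact ⟨f, hd, rfl⟩
  · rintro q ⟨hq, hd⟩
    obtain ⟨p, hp, rfl⟩ := zSpace_contract_le hA hi hq
    refine ⟨symProj K U d p, ⟨symProj_mem_zSpace d hp, symProj_mem d p⟩, ?_⟩
    exact (symProj_symMap _ d p).symm.trans (mem_symPiece_iff.1 hd)

theorem exists_ι_mul_of_mem_zSpace (hA : Admissible K x E k G) {i : ι} (hi : i ∈ E)
    (hspan : spanOn K x (E.erase i) = ⊤) (hxi : x i ≠ 0) {f : SymmetricAlgebra K U}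
    (hf : f ∈ zSpace K x E k G) (h0 : symMap (K ∙ x i).mkQ f = 0) :
    ∃ g ∈ zSpace K x (E.erase i) k G, f = SymmetricAlgebra.ι K U (x i) * g := by
  obtain ⟨g, rfl⟩ := exists_eq_ι_mul_of_symMap_mkQ_eq_zero (x i) f h0
  refine ⟨g, ?_, rfl⟩
  rw [zSpace_eq_zKer (hA.delete hspan)]
  exact mem_zKer_of_ι_mul_mem hA hi hxi (zSpace_le_zKer hA hf)

theorem zSpace_zero_inf_ker (hA : Admissible K x E k G) {i : ι} (hi : i ∈ E)
    (hspan : spanOn K x (E.erase i) = ⊤) (hxi : x i ≠ 0) :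
    (zSpace K x E k G ⊓ symPiece K U 0) ⊓ LinearMap.ker (symMap (K ∙ x i).mkQ).toLinearMap =
      ⊥ := by
  rw [eq_bot_iff]
  rintro f ⟨⟨hf, hd⟩, h0⟩
  obtain ⟨g, -, rfl⟩ := exists_ι_mul_of_mem_zSpace hA hi hspan hxi hf h0
  rw [Submodule.mem_bot, ← mem_symPiece_iff.1 hd, symProj_zero_ι_mul]

/-- Exactness in the middle: elements of the kernel are divisible by `x i`, and the quotient lies in
the space of the deletion, one degree lower. -/
theorem zSpace_succ_inf_ker (hA : Admissible K x E k G) {i : ι} (hi : i ∈ E)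
    (hspan : spanOn K x (E.erase i) = ⊤) (hxi : x i ≠ 0) (d : ℕ) :
    (zSpace K x E k G ⊓ symPiece K U (d + 1)) ⊓
        LinearMap.ker (symMap (K ∙ x i).mkQ).toLinearMap =
      (zSpace K x (E.erase i) k G ⊓ symPiece K U d).map
        (LinearMap.mulLeft K (SymmetricAlgebra.ι K U (x i))) := by
  apply le_antisymm
  · rintro f ⟨⟨hf, hd⟩, h0⟩
    obtain ⟨g, hg, rfl⟩ := exists_ι_mul_of_mem_zSpace hA hi hspan hxi hf h0
    refine ⟨g, ⟨hg, mem_symPiece_iff.2 ?_⟩, rfl⟩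
    have := mem_symPiece_iff.1 hd
    rw [symProj_succ_ι_mul] at this
    exact mul_left_cancel₀ (ι_ne_zero hxi) this
  · rintro _ ⟨g, ⟨hg, hd⟩, rfl⟩
    refine ⟨⟨ι_mul_mem_zSpace hA hi hg, ?_⟩, symMap_ι_mul_eq_zero (x i) g⟩
    rw [SetLike.mem_coe, mem_symPiece_iff, LinearMap.mulLeft_apply, symProj_succ_ι_mul,
      mem_symPiece_iff.1 hd]

variable [FiniteDimensional K U]

instance finite_inf_symPiece (W : Submodule K (SymmetricAlgebra K U)) (d : ℕ) :
    FiniteDimensional K ↥(W ⊓ symPiece K U d) := by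
  have := symPiece_finite K U d
  exact Submodule.finiteDimensional_of_le inf_le_right

theorem finrank_zSpace_zero (hA : Admissible K x E k G) {i : ι} (hi : i ∈ E)
    (hspan : spanOn K x (E.erase i) = ⊤) (hxi : x i ≠ 0) :
    Module.finrank K ↥(zSpace K x E k G ⊓ symPiece K U 0) =
      Module.finrank K ↥(zSpace K (contractVec K x i) (E.erase i) k (fun A => G (insert i A)) ⊓
        symPiece K (U ⧸ (K ∙ x i)) 0) := by
  rw [← finrank_map_add_finrank_inf_ker (symMap (K ∙ x i).mkQ).toLinearMap,
    map_zSpace_inf_symPiece hA hi, zSpace_zero_inf_ker hA hi hspan hxi, finrank_bot, add_zero]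

theorem finrank_zSpace_succ (hA : Admissible K x E k G) {i : ι} (hi : i ∈ E)
    (hspan : spanOn K x (E.erase i) = ⊤) (hxi : x i ≠ 0) (d : ℕ) :
    Module.finrank K ↥(zSpace K x E k G ⊓ symPiece K U (d + 1)) =
      Module.finrank K ↥(zSpace K (contractVec K x i) (E.erase i) k (fun A => G (insert i A)) ⊓
        symPiece K (U ⧸ (K ∙ x i)) (d + 1)) +
      Module.finrank K ↥(zSpace K x (E.erase i) k G ⊓ symPiece K U d) := by
  rw [← finrank_map_add_finrank_inf_ker (symMap (K ∙ x i).mkQ).toLinearMap,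
    map_zSpace_inf_symPiece hA hi, zSpace_succ_inf_ker hA hi hspan hxi]
  congr 1
  refine (Submodule.equivMapOfInjective _ ?_ _).finrank_eq.symm
  exact fun a b hab => mul_left_cancel₀ (ι_ne_zero hxi) hab

end Recursion

/-- Two families of vectors with the same closure operator. -/
def SameClosure (K K' : Type*) [Field K] [Field K'] {U U' : Type*} [AddCommGroup U] [Module K U]
    [AddCommGroup U'] [Module K' U'] (x : ι → U) (x' : ι → U') : Prop :=
  ∀ (A : Finset ι) (j : ι), x j ∈ spanOn K x A ↔ x' j ∈ spanOn K' x' A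

/-! ### Comparison of two representations. -/

section SameClosure

variable {K' : Type*} [Field K']

omit [DecidableEq ι] in
theorem SameClosure.eq_zero_iff {U U' : Type*} [AddCommGroup U] [Module K U]
    [AddCommGroup U'] [Module K' U'] {x : ι → U} {x' : ι → U'} (h : SameClosure K K' x x')
    (i : ι) : x i = 0 ↔ x' i = 0 := by
  simpa [spanOn] using h ∅ i

theorem SameClosure.contract {U U' : Type*} [AddCommGroup U] [Module K U]
    [AddCommGroup U'] [Module K' U'] {x : ι → U} {x' : ι → U'} (h : SameClosure K K' x x')
    (i : ι) : SameClosure K K' (contractVec K x i) (contractVec K' x' i) := by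
  intro A j
  have h1 := h (insert i A) j
  rw [← comap_spanOn_contractVec, ← comap_spanOn_contractVec] at h1
  exact h1

/-- Both dimensions count the elements of degree d in the same set `zExponents E k G`, which
involves neither field nor vectors. -/
theorem finrank_zSpace_eq_of_basis [Infinite K] [Infinite K'] {U U' : Type*} [AddCommGroup U]
    [Module K U] [AddCommGroup U'] [Module K' U'] {k : ℤ} {x : ι → U} {x' : ι → U'}
    {E : Finset ι} {G : Finset ι → Prop} (hA : Admissible K x E k G)
    (hA' : Admissible K' x' E k G) (h : ∀ i ∈ E, x i ∉ spanOn K x (E.erase i))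
    (h' : ∀ i ∈ E, x' i ∉ spanOn K' x' (E.erase i)) (d : ℕ) :
    Module.finrank K ↥(zSpace K x E k G ⊓ symPiece K U d) =
      Module.finrank K' ↥(zSpace K' x' E k G ⊓ symPiece K' U' d) := by
  obtain ⟨b, hb⟩ := exists_basis_of_notMem_span hA.spanning h
  obtain ⟨b', hb'⟩ := exists_basis_of_notMem_span hA'.spanning h'
  rw [zSpace_eq_span_of_basis hA b hb, zSpace_eq_span_of_basis hA' b' hb',
    span_monomials_inf_symPiece, span_monomials_inf_symPiece, finrank_span_monomials,
    finrank_span_monomials]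

/-- The graded dimensions of `zSpace` depend only on the closure operator. -/
theorem finrank_zSpace_eq [Infinite K] [Infinite K'] {k : ℤ} (n : ℕ) :
    ∀ (U : Type w) (U' : Type w') [AddCommGroup U] [Module K U] [FiniteDimensional K U]
      [AddCommGroup U'] [Module K' U'] [FiniteDimensional K' U'] (x : ι → U) (x' : ι → U')
      (E : Finset ι) (G : Finset ι → Prop), E.card = n → Admissible K x E k G →
      Admissible K' x' E k G → SameClosure K K' x x' → ∀ d : ℕ,
      Module.finrank K ↥(zSpace K x E k G ⊓ symPiece K U d) =
        Module.finrank K' ↥(zSpace K' x' E k G ⊓ symPiece K' U' d) := by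
  induction n with
  | zero =>
    intro U U' _ _ _ _ _ _ x x' E G hE hA hA' hxx d
    have hE0 := Finset.card_eq_zero.1 hE
    exact finrank_zSpace_eq_of_basis hA hA' (by simp [hE0]) (by simp [hE0]) d
  | succ n ih =>
    intro U U' _ _ _ _ _ _ x x' E G hE hA hA' hxx d
    by_cases h : ∃ i ∈ E, x i ∈ spanOn K x (E.erase i)
    · obtain ⟨i, hi, hmem⟩ := h
      have hspan := spanOn_erase_eq_top hi hmem hA.spanning
      have hspan' := spanOn_erase_eq_top hi ((hxx _ _).1 hmem) hA'.spanning
      have hcard : (E.erase i).card = n := by rw [Finset.card_erase_of_mem hi, hE]; rfl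
      have hdel := ih U U' x x' (E.erase i) G hcard (hA.delete hspan) (hA'.delete hspan') hxx
      by_cases hxi : x i = 0
      · rw [← zSpace_erase_eq_of_eq_zero hA hi hxi,
          ← zSpace_erase_eq_of_eq_zero hA' hi ((hxx.eq_zero_iff i).1 hxi)]
        exact hdel d
      · have hxi' : x' i ≠ 0 := fun h => hxi ((hxx.eq_zero_iff i).2 h)
        have hcon := ih _ _ _ _ (E.erase i) (fun A => G (insert i A)) hcard (hA.contract hi)
          (hA'.contract hi) (hxx.contract i)
        cases d with
        | zero =>
          rw [finrank_zSpace_zero hA hi hspan hxi, finrank_zSpace_zero hA' hi hspan' hxi', hcon]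
        | succ d =>
          rw [finrank_zSpace_succ hA hi hspan hxi, finrank_zSpace_succ hA' hi hspan' hxi', hcon,
            hdel]
    · push Not at h
      exact finrank_zSpace_eq_of_basis hA hA' h (fun i hi h' => h i hi ((hxx _ _).2 h')) d

end SameClosure

end DeletionContraction

/-! ### From the matroid and its flats to spans and predicates. -/

section Matroid

variable {K : Type*} [Field K] {U : Type*} [AddCommGroup U] [Module K U]
  {ι : Type*} [Finite ι]

/-- A matroid basis I of A has the same span as A by maximality; for independent I, closure and span
have the same description through independence of `insert e I`. -/
theorem mem_closure_linearMatroid_iff (x : ι → U) (A : Set ι) (e : ι) :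
    e ∈ (linearMatroid K x).closure A ↔ x e ∈ Submodule.span K (x '' A) := by
  obtain ⟨I, hI⟩ := (linearMatroid K x).exists_isBasis A (Set.subset_univ A)
  have hli := (linearMatroid_indep_iff K x I).1 hI.indep
  have hspan : Submodule.span K (x '' A) = Submodule.span K (x '' I) := by
    refine le_antisymm (Submodule.span_le.2 ?_)
      (Submodule.span_mono (Set.image_mono hI.subset))
    rintro _ ⟨a, ha, rfl⟩
    rw [SetLike.mem_coe, hli.mem_span_iff]
    intro h
    by_contra haI
    exact haI (hI.mem_of_insert_indep ha ((linearMatroid_indep_iff K x _).2 h))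
  rw [← hI.closure_eq_closure, hI.indep.mem_closure_iff', hspan, hli.mem_span_iff,
    linearMatroid_indep_iff]
  exact ⟨fun h => h.2, fun h => ⟨Set.mem_univ e, h⟩⟩

theorem closure_linearMatroid_eq_univ_iff {x : ι → U} (hx : Submodule.span K (Set.range x) = ⊤)
    (A : Set ι) :
    (linearMatroid K x).closure A = Set.univ ↔ Submodule.span K (x '' A) = ⊤ := by
  rw [Set.eq_univ_iff_forall]
  simp only [mem_closure_linearMatroid_iff]
  constructor
  · intro h
    rw [eq_top_iff, ← hx, Submodule.span_le]
    rintro _ ⟨e, rfl⟩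
    exact h e
  · intro h e
    rw [h]
    exact Submodule.mem_top

theorem admissible_linearMatroid [DecidableEq ι] [Fintype ι] {x : ι → U}
    (hx : Submodule.span K (Set.range x) = ⊤) {k : ℤ} (hk : -1 ≤ k) {J : Set (Set ι)}
    (hJ : IsUpperSetOfFlats (linearMatroid K x) J) (hJne : J.Nonempty)
    (hJH : k = -1 → ∀ C, IsHyperplane (linearMatroid K x) C → C ∈ J) :
    Admissible K x Finset.univ k (fun A => (linearMatroid K x).closure A ∈ J) where
  spanning := by rw [spanOn, Finset.coe_univ, Set.image_univ, hx]
  le := hk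
  mono A B hAB hA := by
    refine hJ.2 _ hA _ (Matroid.isFlat_closure _) fun e he => ?_
    rw [mem_closure_linearMatroid_iff] at he ⊢
    exact hAB he
  ground := by
    obtain ⟨C, hC⟩ := hJne
    refine hJ.2 C hC _ (Matroid.isFlat_closure _) ?_
    rw [(closure_linearMatroid_eq_univ_iff hx _).2
      (by rw [Finset.coe_univ, Set.image_univ, hx])]
    exact Set.subset_univ C
  hyperplane hk A _ i _ hA hins := by
    refine hJH hk _ ⟨Matroid.isFlat_closure _, ?_⟩
    -- Adjoining one element outside the closure raises the rank by exactly one, here to the full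
    -- rank, so the closure of A is a hyperplane.
    have hi : i ∉ (linearMatroid K x).closure A := by
      rw [mem_closure_linearMatroid_iff]
      intro h
      exact hA (spanOn_insert_of_mem h ▸ hins)
    rw [Matroid.eRk_closure_eq, ← Matroid.eRk_insert_eq_add_one ⟨Set.mem_univ i, hi⟩,
      ← Matroid.eRk_closure_eq, (closure_linearMatroid_eq_univ_iff hx _).2
        (by rw [← hins, spanOn, Finset.coe_insert])]
    exact Matroid.eRk_univ_eq _

theorem chi_eq_ind {ι : Type*} (M : Matroid ι) (J : Set (Set ι)) (A : Finset ι) :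
    chi M J A = ind (fun A : Finset ι => M.closure A ∈ J) A := rfl

/-- The inequality for a flat F implies it for every C with closure F: passing from F to C adds
|F∖C| to the right side, at most |F∖C| to the left, and keeps the indicator. -/
theorem internal_condition_iff [Fintype ι] [DecidableEq ι] {x : ι → U}
    (hx : Submodule.span K (Set.range x) = ⊤) (J : Set (Set ι)) (Y : Finset ι) :
    (∀ C : Set ι, (linearMatroid K x).IsFlat C → C ≠ Set.univ →
        (((Y : Set ι) \ C).ncard : ℤ) < (Cᶜ.ncard : ℤ) - 1 + chi (linearMatroid K x) J C) ↔
      ∀ C ⊆ Finset.univ, spanOn K x C ≠ ⊤ → ((Y \ C).card : ℤ) <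
        (Finset.univ \ C).card - 1 + ind (fun A => (linearMatroid K x).closure A ∈ J) C := by
  constructor
  · intro h C _ hC
    obtain ⟨F, hF⟩ := (Set.toFinite ((linearMatroid K x).closure C)).exists_finset_coe
    have h1 := h F (hF ▸ Matroid.isFlat_closure _) (by
      rw [hF, Ne, closure_linearMatroid_eq_univ_iff hx]
      exact hC)
    rw [chi_eq_ind, ← Finset.coe_sdiff, ← Finset.coe_compl, Set.ncard_coe_finset,
      Set.ncard_coe_finset, Finset.compl_eq_univ_sdiff] at h1
    have h2 : ind (fun A : Finset ι => (linearMatroid K x).closure A ∈ J) F =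
        ind (fun A : Finset ι => (linearMatroid K x).closure A ∈ J) C := by
      rw [← chi_eq_ind, ← chi_eq_ind, chi, chi, hF, Matroid.closure_closure]
    have hCF : C ⊆ F := by
      rw [← Finset.coe_subset, hF]
      exact (linearMatroid K x).subset_closure C (Set.subset_univ _)
    have h3 : (Y \ C).card ≤ (Y \ F).card + (F \ C).card := by
      refine (Finset.card_le_card ?_).trans (Finset.card_union_le _ _)
      intro e
      simp only [Finset.mem_sdiff, Finset.mem_union]
      tauto
    have h4 : (Finset.univ \ C).card = (Finset.univ \ F).card + (F \ C).card := by
      rw [← Finset.card_union_of_disjoint, Finset.sdiff_union_sdiff_cancel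
        (Finset.subset_univ F) hCF]
      exact Finset.disjoint_of_subset_right Finset.sdiff_subset Finset.sdiff_disjoint
    omega
  · intro h C hC hCne
    obtain ⟨F, rfl⟩ := (Set.toFinite C).exists_finset_coe
    rw [chi_eq_ind, ← Finset.coe_sdiff, ← Finset.coe_compl, Set.ncard_coe_finset,
      Set.ncard_coe_finset, Finset.compl_eq_univ_sdiff]
    refine h F (Finset.subset_univ _) fun htop => hCne ?_
    rw [← hC.closure]
    exact (closure_linearMatroid_eq_univ_iff hx _).2 htop

/-- The case k = 0 is not separate in `zSpace`: a degree bound of χ - 1 forces χ = 1 and a scalar f.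
-/
theorem pSpace_eq_zSpace [Fintype ι] [DecidableEq ι] {x : ι → U}
    (hx : Submodule.span K (Set.range x) = ⊤) (k : ℤ) (J : Set (Set ι)) :
    pSpace K x k J =
      zSpace K x Finset.univ k (fun A => (linearMatroid K x).closure A ∈ J) := by
  have hcompl : ∀ Y : Finset ι, (Y : Set ι)ᶜ = ((Finset.univ \ Y : Finset ι) : Set ι) := by
    intro Y
    rw [← Finset.compl_eq_univ_sdiff, Finset.coe_compl]
  apply le_antisymm
  · refine Submodule.span_le.2 fun q hq => ?_
    unfold pGenerators at hq
    split_ifs at hq with h1 h0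
    · obtain ⟨Y, hY, rfl⟩ := hq
      exact pProd_mem_zSpace h1 (Finset.subset_univ _) ((internal_condition_iff hx J Y).1 hY)
    · obtain ⟨Y, hY, rfl⟩ := hq
      rw [hcompl] at hY
      rw [← one_mul (pProd K x Y)]
      refine mul_pProd_mem_zSpace h1 (Finset.subset_univ _) (j := 0) ?_ ?_
      · rw [ind_of hY, h0]
        simp
      · rw [symPiece, pow_zero]
        exact Submodule.one_le.1 le_rfl
    · obtain ⟨Y, f, hf, rfl⟩ := hq
      rw [hcompl] at hf
      refine Submodule.subset_span ?_
      rw [zGenerators, if_neg h1]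
      exact ⟨Y, Finset.subset_univ _, f, hf, rfl⟩
  · refine zSpace_le ?_ ?_
    · intro hk Y _ hY
      refine Submodule.subset_span ?_
      rw [pGenerators, if_pos hk]
      exact ⟨Y, (internal_condition_iff hx J Y).2 hY, rfl⟩
    · intro hk Y _ j hj f hf
      by_cases h0 : k = 0
      · by_cases hY : (linearMatroid K x).closure ((Finset.univ \ Y : Finset ι) : Set ι) ∈ J
        · rw [ind_of hY, h0] at hj
          obtain rfl : j = 0 := by omega
          rw [symPiece, pow_zero, Submodule.mem_one] at hf
          obtain ⟨c, rfl⟩ := hf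
          rw [← Algebra.smul_def]
          refine Submodule.smul_mem _ _ (Submodule.subset_span ?_)
          rw [pGenerators, if_neg hk, if_pos h0]
          exact ⟨Y, by rwa [hcompl], rfl⟩
        · rw [ind, if_neg hY, h0] at hj
          omega
      · refine Submodule.subset_span ?_
        rw [pGenerators, if_neg hk, if_neg h0]
        refine ⟨Y, f, Submodule.mem_iSup_of_mem j (Submodule.mem_iSup_of_mem ?_ hf), rfl⟩
        rw [hcompl]
        exact hj

theorem sameClosure_of_linearMatroid_eq {K' : Type*} [Field K'] {U' : Type*} [AddCommGroup U']
    [Module K' U'] {x : ι → U} {x' : ι → U'} (hM : linearMatroid K x = linearMatroid K' x') :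
    SameClosure K K' x x' := by
  intro A j
  rw [spanOn, spanOn, ← mem_closure_linearMatroid_iff, ← mem_closure_linearMatroid_iff, hM]

end Matroid

end Zonotopal

theorem mainTheorem9
    {K K' : Type*} [Field K] [CharZero K] [Field K'] [CharZero K']
    {U U' : Type*} [AddCommGroup U] [Module K U] [FiniteDimensional K U]
    [AddCommGroup U'] [Module K' U'] [FiniteDimensional K' U']
    (hr : 1 ≤ Module.finrank K U) (hr' : 1 ≤ Module.finrank K' U')
    {N : ℕ} (x : Fin N → U) (x' : Fin N → U')
    (hx : Submodule.span K (Set.range x) = ⊤) (hx' : Submodule.span K' (Set.range x') = ⊤)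
    (hM : Zonotopal.linearMatroid K x = Zonotopal.linearMatroid K' x')
    (k : ℤ) (hk : -1 ≤ k)
    (J : Set (Set (Fin N)))
    (hJ : Zonotopal.IsUpperSetOfFlats (Zonotopal.linearMatroid K x) J) (hJne : J.Nonempty)
    (hJH : k = -1 → ∀ C, Zonotopal.IsHyperplane (Zonotopal.linearMatroid K x) C → C ∈ J) :
    Zonotopal.hilbertSeries (Zonotopal.pSpace K x k J) =
      Zonotopal.hilbertSeries (Zonotopal.pSpace K' x' k J) := by
  have : Infinite K := CharZero.infinite K
  have : Infinite K' := CharZero.infinite K'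
  have hA := Zonotopal.admissible_linearMatroid hx hk hJ hJne hJH
  have hA' := Zonotopal.admissible_linearMatroid hx' hk (hM ▸ hJ) hJne (hM ▸ hJH)
  rw [Zonotopal.pSpace_eq_zSpace hx, Zonotopal.pSpace_eq_zSpace hx', ← hM]
  rw [← hM] at hA'
  ext d
  rw [Zonotopal.hilbertSeries, Zonotopal.hilbertSeries, PowerSeries.coeff_mk, PowerSeries.coeff_mk]
  exact Zonotopal.finrank_zSpace_eq _ U U' x x' _ _ rfl hA hA'
    (Zonotopal.sameClosure_of_linearMatroid_eq hM) d
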